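/- **Setting.** Let $q$ be a power of an odd prime, $n$ a natural number, and let $N=2n+1,\ \tilde n=n+1$ for type $\mathfrak B_n$, and $N=2n,\ \tilde n=n$ for types $\mathfrak C_n$ and $\mathfrak D_n$. Put $\bar i=N+1-i$ for $1\le i\le N$, and let $S=\sum_{i=1}^n e_{i\bar i}+\epsilon\sum_{i=n+1}^N e_{i\bar i}$ with $\epsilon=-1$ for type $\mathfrak C_n$ and $\epsilon=1$ otherwise. Let $U$ be the group of upper unitriangular matrices $u\in GL_N(\mathbb F_q)$ with $u^tSu=S$. Let $\Phi^+=\{(i,j)\mid i<j<\bar i\}$ for types $\mathfrak B_n,\mathfrak D_n$ and $\Phi^+=\{(i,j)\mid i<j\le\bar i\}$ for type $\mathfrak C_n$. For $(i,j)\in\Phi^+$ and $\alpha\in\mathbb F_q$ define $x_{ij}(\alpha)\in U$ as follows: $x_{ij}(\alpha)=1+\alpha e_{ij}-\alpha e_{\bar j\bar i}$, except that in type $\mathfrak B_n$, $x_{i,n+1}(\alpha)=1+\alpha e_{i,n+1}-\alpha e_{n+1,\bar i}-\tfrac12\alpha^2e_{i\bar i}$, and in type $\mathfrak C_n$, $x_{ij}(\alpha)=1+\alpha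 e_{ij}+\alpha e_{\bar j\bar i}$ for $n<j<\bar i$ and $x_{i\bar i}(\alpha)=1+\alpha e_{i\bar i}$. For $J\subseteq\Phi^+$ let $U_J$ be the subgroup generated by all $x_{ij}(\alpha)$ with $(i,j)\in J$, $\alpha\in\mathbb F_q$. Let $V$ be the space of $N\times N$ matrices over $\mathbb F_q$ supported in $\Phi^+$, and $\pi$ the projection of all matrices onto $V$ that sets the entries outside $\Phi^+$ to zero. Fix a nontrivial character $\theta:(\mathbb F_q,+)\to\mathbb C^*$. For $A\in V$ let $[A]$ be the linear character $B\mapsto\theta(-\operatorname{tr}(A^tB))$ of $(V,+)$; these are all the linear characters of $V$. The group $U$ acts on the set of these characters by $(\chi.u)(B)=\chi(\pi(Bu^{-1}))$; let $\mathcal O_A=\{[A].u\mid u\in U\}$. A *main condition* of $A$ is the position of the rightmost nonzero entry of a nonzero row of $A$; it is *left* if its column is $\le\tilde n$ and *right* otherwise. $[A]$ is a *staircase* character if its main conditions lie in pairwise different columns; a staircase orbit is an orbit $\mathcal O_A$ with $[A]$ staircase. For a staircase character $[A]$: * the *minor conditions* are the positions $(i,\bar j)$ with $(i,j)$ a right main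 condition; * a *supplementary condition* is a position $(i,j)\in\Phi^+$, $j\le\tilde n$, that is neither a main nor a minor condition, lies in the column of some minor condition, and lies to the left, in the same row, of some minor or left main condition; * $\operatorname{core}(A)$ consists of the main, minor and supplementary conditions in types $\mathfrak B_n,\mathfrak D_n$, and of the main and supplementary conditions in type $\mathfrak C_n$; $[A]$ is a *core character* if it is staircase and $A$ is supported in $\operatorname{core}(A)$; * $\operatorname{Pl}(A)$, the set of *places*, consists of the positions in $\Phi^+\setminus\operatorname{core}(A)$ that lie to the left, in the same row, of a main condition; * $\operatorname{Limb}(A)$ is the union, over all main conditions $(i,j)$, of the leg $\{(a,j)\in\Phi^+\mid a>i\}$ and the arm, which is $\{(\bar j,a)\in\Phi^+\}$ if $j\ne\bar i$ and $\{(i,a)\mid i<a<\bar i\}$ if $j=\bar i$; * $J(A)=\Phi^+\setminus\operatorname{Limb}(A)$, and $\operatorname{verge}(A)=\sum A_{ij}e_{ij}$, summed over the main conditions $(i,j)$ of $A$. **Theorem.** Let $[A]$ be a staircase character. For every map $\Lambda:\operatorname{Pl}(A)\to\mathbb F_q$, $(i,j)\mapsto\lambda_{ij}$, there is exactly one $[B]=[B(\Lambda)]\in\mathcal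 O_A$ with $B_{ij}=\lambda_{ij}$ for all $(i,j)\in\operatorname{Pl}(A)$, and $\Lambda\mapsto[B(\Lambda)]$ is a bijection from the set of all such maps onto $\mathcal O_A$. In particular $\mathcal O_A$ contains exactly one core character, namely $[B(\Lambda_0)]$ with $\Lambda_0=0$. Moreover $U_{J(A)}$ is a subgroup of $U$ and $$|\mathcal O_A|=q^{|\operatorname{Pl}(A)|}=q^{|\operatorname{Limb}(A)|}=q^{|\operatorname{Limb}(\operatorname{verge}(A))|}=[U:U_{J(A)}].$$ Consequently the core characters classify the staircase orbits: $[A]\mapsto\mathcal O_A$ is a bijection from the set of core characters onto the set of staircase orbits. -/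

import Mathlib

open Matrix

noncomputable section

/-- The untwisted classical Dynkin types `B_n`, `C_n`, `D_n`. -/
inductive LieType where
  | B
  | C
  | D
  deriving DecidableEq

namespace LieType

/-- The size `N` of the matrices: `2n+1` in type `B_n`, `2n` in types `C_n`, `D_n`. -/
def size : LieType → ℕ → ℕ
  | B, n => 2 * n + 1
  | C, n => 2 * n
  | D, n => 2 * n

/-- `ñ = n+1` in type `B_n` and `ñ = n` in types `C_n`, `D_n`. -/
def tildeN : LieType → ℕ → ℕ
  | B, n => n + 1
  | C, n => n
  | D, n => n

/-- Row and column indices. Indices are counted from `0`, so the index written `i` in the usual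
`1`-based convention has value `i - 1`; the mirror map `i ↦ N + 1 - i` is `Fin.rev`. -/
abbrev Idx (X : LieType) (n : ℕ) : Type := Fin (X.size n)

/-- Matrix positions. -/
abbrev Pos (X : LieType) (n : ℕ) : Type := X.Idx n × X.Idx n

variable (X : LieType) (n : ℕ)

/-- Positions strictly above the diagonal and strictly above the antidiagonal. -/
def up : Set (X.Pos n) := {p | p.1 < p.2 ∧ p.2 < p.1.rev}

/-- The part of the antidiagonal above the diagonal. -/
def antidiag : Set (X.Pos n) := {p | p.1 < p.2 ∧ p.1 = p.2.rev}

/-- The positive roots: `up` in types `B_n`, `D_n`; `up` with the half antidiagonal in type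
`C_n`. -/
def posRoots : Set (X.Pos n) := {p | p ∈ X.up n ∨ (X = C ∧ p ∈ X.antidiag n)}

/-- Positive roots in columns `1, …, ñ`. -/
def leftPart : Set (X.Pos n) := {p | p ∈ X.posRoots n ∧ (p.2 : ℕ) < X.tildeN n}

/-- Positive roots in columns `ñ + 1, …, N`. -/
def rightPart : Set (X.Pos n) := {p | p ∈ X.posRoots n ∧ X.tildeN n ≤ (p.2 : ℕ)}

section Groups

variable (F : Type*) [Field F]

/-- The Gram matrix `S`: antidiagonal, with entry `-1` in rows `n+1, …, N` for type `C_n`, and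
entry `1` otherwise. -/
def gram : Matrix (X.Idx n) (X.Idx n) F :=
  Matrix.of fun i j => if j = i.rev then (if X = C ∧ n ≤ (i : ℕ) then -1 else 1) else 0

/-- The classical group `G` of invertible matrices preserving the form with Gram matrix `S`. -/
def classicalGroup : Subgroup (GL (X.Idx n) F) where
  carrier := {g | (g.val)ᵀ * X.gram n F * g.val = X.gram n F}
  one_mem' := by simp
  mul_mem' := by
    intro a b ha hb
    simp only [Set.mem_ofPred_eq, Units.val_mul, Matrix.transpose_mul] at *
    calc b.valᵀ * a.valᵀ * X.gram n F * (a.val * b.val)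
        = b.valᵀ * (a.valᵀ * X.gram n F * a.val) * b.val := by simp only [Matrix.mul_assoc]
      _ = X.gram n F := by rw [ha, hb]
  inv_mem' := by
    intro a ha
    simp only [Set.mem_ofPred_eq] at *
    have h1 : a.val * (a⁻¹).val = 1 := by rw [← Units.val_mul]; simp
    have h2 : (a⁻¹).valᵀ * a.valᵀ = 1 := by rw [← Matrix.transpose_mul, h1]; simp
    calc (a⁻¹).valᵀ * X.gram n F * (a⁻¹).val
        = (a⁻¹).valᵀ * (a.valᵀ * X.gram n F * a.val) * (a⁻¹).val := by rw [ha]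
      _ = ((a⁻¹).valᵀ * a.valᵀ) * X.gram n F * (a.val * (a⁻¹).val) := by
          simp only [Matrix.mul_assoc]
      _ = X.gram n F := by rw [h1, h2]; simp

/-- The group of upper unitriangular `N × N` matrices. -/
def unitriangular : Subgroup (GL (X.Idx n) F) where
  carrier := {g | (∀ i j, j < i → g.val i j = 0) ∧ ∀ i, g.val i i = 1}
  one_mem' := by
    refine ⟨fun i j h => ?_, fun i => ?_⟩
    · simp [h.ne']
    · simp
  mul_mem' := by
    rintro a b ⟨ha, ha'⟩ ⟨hb, hb'⟩
    refine ⟨fun i j h => ?_, fun i => ?_⟩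
    · rw [Units.val_mul, Matrix.mul_apply]
      refine Finset.sum_eq_zero fun k _ => ?_
      rcases lt_or_ge k i with hk | hk
      · rw [ha i k hk, zero_mul]
      · rw [hb k j (h.trans_le hk), mul_zero]
    · rw [Units.val_mul, Matrix.mul_apply, Finset.sum_eq_single i]
      · rw [ha', hb', one_mul]
      · intro k _ hk
        rcases lt_or_gt_of_ne hk with hk | hk
        · rw [ha i k hk, zero_mul]
        · rw [hb k i hk, mul_zero]
      · simp
  inv_mem' := by
    rintro a ⟨ha, ha'⟩
    have hab : a.val * (a⁻¹).val = 1 := by rw [← Units.val_mul]; simp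
    have ht : ∀ i j, j < i → (a⁻¹).val i j = 0 := by
      have h : Matrix.BlockTriangular a.val id := fun i j h => ha i j h
      have : Invertible a.val := a.isUnit.invertible
      have h' := Matrix.blockTriangular_inv_of_blockTriangular h
      intro i j hij
      rw [Matrix.coe_units_inv]
      exact h' hij
    refine ⟨ht, fun i => ?_⟩
    have h := congrFun (congrFun hab i) i
    rw [Matrix.mul_apply, Finset.sum_eq_single i] at h
    · simpa [ha'] using h
    · intro k _ hk
      rcases lt_or_gt_of_ne hk with hk | hk
      · rw [ha i k hk, zero_mul]
      · rw [ht k i hk, mul_zero]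
    · simp

/-- The Sylow subgroup `U`, the upper unitriangular elements of the classical group. -/
def sylowU : Subgroup (GL (X.Idx n) F) := X.classicalGroup n F ⊓ X.unitriangular n F

variable {F}

/-- The root subgroup element `x_{ij}(α)` at the position `p = (i, j)`. -/
def rootElem (p : X.Pos n) (α : F) : Matrix (X.Idx n) (X.Idx n) F :=
  match X with
  | B =>
    if (p.2 : ℕ) = n then
      1 + single p.1 p.2 α - single p.2 p.1.rev α - single p.1 p.1.rev (α ^ 2 / 2)
    else 1 + single p.1 p.2 α - single p.2.rev p.1.rev α
  | C =>
    if p.2 = p.1.rev then 1 + single p.1 p.2 α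
    else if (p.2 : ℕ) < n then 1 + single p.1 p.2 α - single p.2.rev p.1.rev α
    else 1 + single p.1 p.2 α + single p.2.rev p.1.rev α
  | D => 1 + single p.1 p.2 α - single p.2.rev p.1.rev α

variable (F)

/-- The subgroup generated by the root subgroups at positions in `J`. -/
def patternSubgroup (J : Set (X.Pos n)) : Subgroup (GL (X.Idx n) F) :=
  Subgroup.closure {g | ∃ p ∈ J, ∃ α : F, g.val = X.rootElem n p α}

end Groups

section Characters

variable (F : Type*) [Field F]

/-- The space `V` of matrices supported on the positive roots. -/
def V : Submodule F (Matrix (X.Idx n) (X.Idx n) F) where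
  carrier := {A | ∀ i j, (i, j) ∉ X.posRoots n → A i j = 0}
  zero_mem' := fun _ _ _ => rfl
  add_mem' := by
    intro a b ha hb i j h
    rw [Matrix.add_apply, ha i j h, hb i j h, add_zero]
  smul_mem' := by
    intro c a ha i j h
    rw [Matrix.smul_apply, ha i j h, smul_zero]

variable {F}

open Classical in
/-- The projection `π` onto `V` that sets all entries outside the positive roots to zero. -/
def proj : Matrix (X.Idx n) (X.Idx n) F →ₗ[F] X.V n F where
  toFun A := ⟨Matrix.of fun i j => if (i, j) ∈ X.posRoots n then A i j else 0, by
    intro i j h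
    simp [h]⟩
  map_add' A B := by
    ext i j
    by_cases h : (i, j) ∈ X.posRoots n <;> simp [h]
  map_smul' c A := by
    ext i j
    by_cases h : (i, j) ∈ X.posRoots n <;> simp [h]

variable {X n}

/-- The action `A.u = π(A u)` on `V`. -/
def actV (u : GL (X.Idx n) F) : X.V n F →ₗ[F] X.V n F :=
  X.proj n ∘ₗ LinearMap.mulRight F u.val ∘ₗ (X.V n F).subtype

/-- The action `(χ.u)(B) = χ(B.u⁻¹)` on the linear characters of the additive group of `V`. -/
def actChar (χ : AddChar (X.V n F) ℂ) (u : GL (X.Idx n) F) : AddChar (X.V n F) ℂ :=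
  χ.compAddMonoidHom (actV u⁻¹).toAddMonoidHom

/-- The linear form `τ_A = κ(A, -)` on `V`, where `κ(A, B) = tr(Aᵗ B)`. -/
def tau (A : X.V n F) : X.V n F →ₗ[F] F :=
  Matrix.traceLinearMap (X.Idx n) F F ∘ₗ LinearMap.mulLeft F (A.val)ᵀ ∘ₗ (X.V n F).subtype

/-- The linear character `χ_A = θ ∘ τ_A` of `V`. -/
def chi (θ : AddChar F ℂ) (A : X.V n F) : AddChar (X.V n F) ℂ :=
  θ.compAddMonoidHom (tau A).toAddMonoidHom

/-- The linear character `[A] = χ_{-A}` of `V`. -/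
def bracket (θ : AddChar F ℂ) (A : X.V n F) : AddChar (X.V n F) ℂ := chi θ (-A)

/-- The `U`-orbit `O_A = {[A].u | u ∈ U}`. -/
def orbit (θ : AddChar F ℂ) (A : X.V n F) : Set (AddChar (X.V n F) ℂ) :=
  {χ | ∃ u ∈ X.sylowU n F, χ = actChar (bracket θ A) u}

/-- The main conditions of `A`: the positions of the rightmost nonzero entries of the nonzero
rows. -/
def mainConds (A : X.V n F) : Set (X.Pos n) :=
  {p | p ∈ X.posRoots n ∧ A.val p.1 p.2 ≠ 0 ∧ ∀ k, p.2 < k → A.val p.1 k = 0}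

/-- The left main conditions. -/
def leftMain (A : X.V n F) : Set (X.Pos n) := mainConds A ∩ X.leftPart n

/-- The right main conditions. -/
def rightMain (A : X.V n F) : Set (X.Pos n) := mainConds A ∩ X.rightPart n

/-- `[A]` is a staircase character: its main conditions lie in different columns. -/
def IsStaircase (A : X.V n F) : Prop := Set.InjOn Prod.snd (mainConds A)

/-- The minor conditions `(i, j̄)` for right main conditions `(i, j)`. In type `C_n` they may lie
on the diagonal, hence outside the positive roots. -/
def minorConds (A : X.V n F) : Set (X.Pos n) := {p | (p.1, p.2.rev) ∈ rightMain A}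

/-- `p` lies strictly to the left of `r`, in the same row. -/
def LeftOf (p r : X.Pos n) : Prop := p.1 = r.1 ∧ p.2 < r.2

/-- The supplementary conditions. -/
def supplConds (A : X.V n F) : Set (X.Pos n) :=
  {p | p ∈ X.leftPart n ∧ (∃ r ∈ minorConds A ∪ leftMain A, LeftOf p r) ∧
    (∃ r ∈ minorConds A, r.2 = p.2) ∧ p ∉ minorConds A ∧ p ∉ mainConds A}

/-- The core: main, minor and supplementary conditions in types `B_n`, `D_n`; main and
supplementary conditions in type `C_n`. -/
def core (A : X.V n F) : Set (X.Pos n) :=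
  {p | p ∈ mainConds A ∨ (X ≠ C ∧ p ∈ minorConds A) ∨ p ∈ supplConds A}

/-- `[A]` is a core character: a staircase character with support in its core. -/
def IsCore (A : X.V n F) : Prop :=
  IsStaircase A ∧ ∀ i j, A.val i j ≠ 0 → (i, j) ∈ core A

open Classical in
/-- The verge of `A`: the entries at the main conditions, all other entries replaced by `0`. -/
def verge (A : X.V n F) : X.V n F :=
  ⟨Matrix.of fun i j => if (i, j) ∈ mainConds A then A.val i j else 0, by
    intro i j h
    simp [A.property i j h]⟩

/-- The places of `A`: non-core positions to the left of a main condition. -/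
def places (A : X.V n F) : Set (X.Pos n) :=
  {p | p ∈ X.posRoots n ∧ p ∉ core A ∧ ∃ r ∈ mainConds A, LeftOf p r}

/-- The arm at a positive root `(i, j)`: all positive roots in row `j̄` if `(i, j)` is off the
antidiagonal, and the positions of `up` in row `i` if `j = ī` (which occurs in type `C_n`). -/
def arm (r : X.Pos n) : Set (X.Pos n) :=
  {p | (r ∈ X.up n ∧ p ∈ X.posRoots n ∧ p.1 = r.2.rev) ∨
    (r ∈ X.antidiag n ∧ p ∈ X.up n ∧ p.1 = r.1)}

/-- The leg at `(i, j)`: the positive roots in column `j` below `(i, j)`. -/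
def leg (r : X.Pos n) : Set (X.Pos n) :=
  {p | p ∈ X.posRoots n ∧ p.2 = r.2 ∧ r.1 < p.1}

/-- The union of all legs and arms at main conditions of `A`. -/
def limb (A : X.V n F) : Set (X.Pos n) :=
  {p | ∃ r ∈ mainConds A, p ∈ leg r ∨ p ∈ arm r}

/-- The complement `J(A)` of the limbs in the positive roots. -/
def complLimb (A : X.V n F) : Set (X.Pos n) := X.posRoots n \ limb A

end Characters

end LieType

end

open Matrix

noncomputable section

namespace LieType

variable {X : LieType} {n : ℕ}

/-! Through `bracket`, which is injective since `θ` is nontrivial, the orbit becomes an orbit of the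
left action `g • A = π(A gᵗ)` on `V` (`orbit_eq_image`). As `gᵗ` is lower unitriangular, entries
only spread to the left, so main conditions, and with them core, places and limbs, are constant on
orbits.

Places are coordinates on a staircase orbit. They determine an element because `A S Aᵗ` is unchanged
when `A` becomes `A gᵗ`: working through the columns from the right, pairing a row with itself
recovers a minor entry (2 is invertible), and pairing two rows recovers a supplementary entry
(`smul_eq_smul_of_places`). They are free because a root element can adjust one place without
disturbing the places already treated, in a suitable order (`exists_smul_entry`,
`exists_smul_places`). Hence the orbit has `q ^ |Pl(A)|` elements, and the core character is the one
vanishing at all places (`isCore_iff`).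

A place `(k, m)` in a row with main column `j` corresponds to `(m, j)` or its mirror image, which
gives `|Pl| = |Limb|` (`ncard_places_eq_ncard_limb`). For the index, the verge has the main
conditions of `A`, hence an orbit of the same size, and its stabilizer is `U_{J(A)}`
(`subgroupOf_patternSubgroup_complLimb`); orbit-stabilizer finishes. -/

theorem mem_posRoots {i j : X.Idx n} :
    (i, j) ∈ X.posRoots n ↔ i < j ∧ (j < i.rev ∨ (X = C ∧ j = i.rev)) := by
  simp only [posRoots, up, antidiag, Set.mem_ofPred_eq]
  constructor
  · rintro (h | ⟨hX, h, h'⟩)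
    · exact ⟨h.1, Or.inl h.2⟩
    · exact ⟨h, Or.inr ⟨hX, by rw [h', Fin.rev_rev]⟩⟩
  · rintro ⟨h, h' | ⟨hX, h'⟩⟩
    · exact Or.inl ⟨h, h'⟩
    · exact Or.inr ⟨hX, h, by rw [h', Fin.rev_rev]⟩

theorem lt_tildeN_iff (j : X.Idx n) : (j : ℕ) < X.tildeN n ↔ j ≤ j.rev := by
  have hj := j.isLt
  rw [Fin.le_def, Fin.val_rev]
  cases X <;> simp only [size, tildeN] at * <;> omega

theorem tildeN_le_iff (j : X.Idx n) : X.tildeN n ≤ (j : ℕ) ↔ j.rev < j := by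
  rw [← not_lt, lt_tildeN_iff, not_le]

theorem mem_leftPart {i j : X.Idx n} :
    (i, j) ∈ X.leftPart n ↔ (i, j) ∈ X.posRoots n ∧ j ≤ j.rev := by
  simp only [leftPart, Set.mem_ofPred_eq, lt_tildeN_iff]

theorem mem_rightPart {i j : X.Idx n} :
    (i, j) ∈ X.rightPart n ↔ (i, j) ∈ X.posRoots n ∧ j.rev < j := by
  simp only [rightPart, Set.mem_ofPred_eq, tildeN_le_iff]

/-! ### Root elements: membership in `U` and entries. -/

section Groups

variable {F : Type*} [Field F]

variable (F) in
/-- The nonzero entry of the Gram matrix in row `i`. -/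
def gramSign (i : X.Idx n) : F := if X = C ∧ n ≤ (i : ℕ) then -1 else 1

theorem gram_apply (i j : X.Idx n) :
    X.gram n F i j = if j = i.rev then gramSign F i else 0 := rfl

theorem gramSign_ne_zero (i : X.Idx n) : gramSign F i ≠ 0 := by
  unfold gramSign; split_ifs <;> simp

theorem gramSign_of_ne_C (hX : X ≠ C) (i : X.Idx n) : gramSign F i = 1 := by
  simp [gramSign, hX]

theorem gram_mul_apply (M : Matrix (X.Idx n) (X.Idx n) F) (i j : X.Idx n) :
    (X.gram n F * M) i j = gramSign F i * M i.rev j := by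
  simp [Matrix.mul_apply, gram_apply]

theorem gram_mul_single (i j : X.Idx n) (α : F) :
    X.gram n F * single i j α = single i.rev j (gramSign F i.rev * α) := by
  ext a b
  rw [gram_mul_apply]
  simp only [single_apply]
  by_cases h : i = a.rev
  · subst h; simp
  · have : i.rev ≠ a := fun h' => h (by rw [← h', Fin.rev_rev])
    simp [h, this]

theorem single_mul_gram (i j : X.Idx n) (α : F) :
    single i j α * X.gram n F = single i j.rev (α * gramSign F j) := by
  ext a b
  rw [Matrix.mul_apply]
  simp only [single_apply, gram_apply]
  by_cases h : i = a
  · rw [Finset.sum_eq_single j]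
    · by_cases hb : b = j.rev <;> simp [h, hb, eq_comm]
    · intro k _ hk; simp [hk.symm]
    · simp
  · simp [h]

/-- A common shape for the root elements of all types off the antidiagonal. Expanding `gᵗ S g`
leaves surplus matrix units at `(b, ā)`, `(ā, b)` and `(ā, ā)`; the three hypotheses say that their
coefficients vanish. Only the middle column `b = b̄` of type B needs `γ`. -/
theorem preserves_of_singles {a b : X.Idx n} {α β γ : F} (hab : a < b) (hba : b < a.rev)
    (h₁ : α * gramSign F a + β * gramSign F b = 0)
    (h₂ : α * gramSign F a.rev + β * gramSign F b.rev = 0)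
    (h₃ : (b ≠ b.rev ∧ γ = 0) ∨
      (b = b.rev ∧ β * gramSign F b.rev * β + (gramSign F a + gramSign F a.rev) * γ = 0)) :
    (1 + single a b α + single b.rev a.rev β + single a a.rev γ)ᵀ * X.gram n F *
      (1 + single a b α + single b.rev a.rev β + single a a.rev γ) = X.gram n F := by
  have e₁ : a.rev ≠ a := (hab.trans hba).ne'
  have e₂ : b ≠ a := hab.ne'
  have e₅ : a.rev ≠ b.rev := fun h => e₂ (Fin.rev_injective h).symm
  have z {j k : X.Idx n} (h : j ≠ k) (i l : X.Idx n) (c d : F) :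
      single i j c * single k l d = 0 := single_mul_single_of_ne _ _ _ _ h _
  have k₁ : single b a.rev (α * gramSign F a) + single b a.rev (gramSign F b * β) = 0 := by
    rw [← single_add, show α * gramSign F a + gramSign F b * β = 0 by linear_combination h₁,
      single_zero]
  have k₂ : single a.rev b (β * gramSign F b.rev) +
      single a.rev b (gramSign F a.rev * α) = 0 := by
    rw [← single_add, show β * gramSign F b.rev + gramSign F a.rev * α = 0 by
      linear_combination h₂, single_zero]
  have k₃ : single a.rev b (β * gramSign F b.rev) * single b.rev a.rev β +
      single a.rev a.rev (γ * gramSign F a) + single a.rev a.rev (gramSign F a.rev * γ) = 0 := by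
    rcases h₃ with ⟨hb, h⟩ | ⟨hb, h⟩
    · rw [single_mul_single_of_ne (h := hb), h]; simp
    · rw [← hb, single_mul_single_same, ← single_add, ← single_add,
        show β * gramSign F b * β + γ * gramSign F a + gramSign F a.rev * γ = 0 by
          rw [← hb] at h; linear_combination h, single_zero]
  simp only [transpose_add, transpose_one, transpose_single, add_mul, mul_add, one_mul, mul_one,
    gram_mul_single, single_mul_gram, Fin.rev_rev, z e₁, z e₂, z e₅]
  linear_combination (norm := abel) k₁ + k₂ + k₃

theorem preserves_of_single {a : X.Idx n} {α : F} (ha : a < a.rev)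
    (h : gramSign F a + gramSign F a.rev = 0) :
    (1 + single a a.rev α)ᵀ * X.gram n F * (1 + single a a.rev α) = X.gram n F := by
  have z (i l : X.Idx n) (c d : F) : single i a.rev c * single a l d = 0 :=
    single_mul_single_of_ne _ _ _ _ ha.ne' _
  have k : single a.rev a.rev (α * gramSign F a) +
      single a.rev a.rev (gramSign F a.rev * α) = 0 := by
    rw [← single_add, show α * gramSign F a + gramSign F a.rev * α = 0 by
      linear_combination α * h, single_zero]
  simp only [transpose_add, transpose_one, transpose_single, add_mul, mul_add, one_mul, mul_one,
    gram_mul_single, single_mul_gram, z]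
  linear_combination (norm := abel) k

/-- The shape of a root subgroup element off the antidiagonal. -/
theorem rootElem_of_up (hF : (2 : F) ≠ 0) {a b : X.Idx n} (hab : a < b) (hba : b < a.rev)
    (α : F) :
    ∃ β γ : F, X.rootElem n (a, b) α =
        1 + single a b α + single b.rev a.rev β + single a a.rev γ ∧
      α * gramSign F a + β * gramSign F b = 0 ∧
      α * gramSign F a.rev + β * gramSign F b.rev = 0 ∧
      ((b ≠ b.rev ∧ γ = 0) ∨ (b = b.rev ∧
        β * gramSign F b.rev * β + (gramSign F a + gramSign F a.rev) * γ = 0)) := by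
  have ha := a.isLt
  have hb := b.isLt
  rw [Fin.lt_def] at hab hba
  rw [Fin.val_rev] at hba
  cases X
  · simp only [size] at ha hb hba
    have hs := fun i => gramSign_of_ne_C (X := B) (n := n) (F := F) (by decide) i
    by_cases h : (b : ℕ) = n
    · have hb' : b = b.rev := Fin.ext (by rw [Fin.val_rev]; simp only [size]; omega)
      refine ⟨-α, -(α ^ 2 / 2), ?_, by simp [hs], by simp [hs], Or.inr ⟨hb', ?_⟩⟩
      · rw [← hb', ← single_neg, ← single_neg]; simp [rootElem, h, sub_eq_add_neg]
      · rw [hs, hs, hs]; field_simp; ring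
    · have hb' : b ≠ b.rev := fun h' => h (by
        have := congrArg Fin.val h'; rw [Fin.val_rev] at this; simp only [size] at this; omega)
      refine ⟨-α, 0, ?_, by simp [hs], by simp [hs], Or.inl ⟨hb', rfl⟩⟩
      rw [← single_neg]; simp [rootElem, h, sub_eq_add_neg]
  · simp only [size] at ha hb hba
    have h₀ : b ≠ a.rev := fun h' => by
      have := congrArg Fin.val h'; rw [Fin.val_rev] at this; simp only [size] at this; omega
    have hb' : b ≠ b.rev := fun h' => by
      have := congrArg Fin.val h'; rw [Fin.val_rev] at this; simp only [size] at this; omega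
    have ga : gramSign F a = 1 := by simp [gramSign]; omega
    have ga' : gramSign F a.rev = -1 := by
      rw [gramSign, if_pos ⟨rfl, by rw [Fin.val_rev]; simp only [size]; omega⟩]
    by_cases h : (b : ℕ) < n
    · have gb : gramSign F b = 1 := by simp [gramSign]; omega
      have gb' : gramSign F b.rev = -1 := by
        rw [gramSign, if_pos ⟨rfl, by rw [Fin.val_rev]; simp only [size]; omega⟩]
      refine ⟨-α, 0, ?_, by simp [ga, gb], by simp [ga', gb'], Or.inl ⟨hb', rfl⟩⟩
      rw [← single_neg]; simp [rootElem, h, h₀, sub_eq_add_neg]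
    · have gb : gramSign F b = -1 := by simp [gramSign]; omega
      have gb' : gramSign F b.rev = 1 := by
        rw [gramSign, if_neg fun h' => by rw [Fin.val_rev] at h'; simp only [size] at h'; omega]
      refine ⟨α, 0, ?_, by simp [ga, gb], by simp [ga', gb'], Or.inl ⟨hb', rfl⟩⟩
      simp [rootElem, h, h₀]
  · simp only [size] at ha hb hba
    have hs := fun i => gramSign_of_ne_C (X := D) (n := n) (F := F) (by decide) i
    have hb' : b ≠ b.rev := fun h' => by
      have := congrArg Fin.val h'; rw [Fin.val_rev] at this; simp only [size] at this; omega
    refine ⟨-α, 0, ?_, by simp [hs], by simp [hs], Or.inl ⟨hb', rfl⟩⟩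
    rw [← single_neg]; simp [rootElem, sub_eq_add_neg]

theorem rootElem_of_antidiag (hX : X = C) (a : X.Idx n) (α : F) :
    X.rootElem n (a, a.rev) α = 1 + single a a.rev α := by
  subst hX
  simp [rootElem]

theorem rootElem_preserves (hF : (2 : F) ≠ 0) {p : X.Pos n} (hp : p ∈ X.posRoots n) (α : F) :
    (X.rootElem n p α)ᵀ * X.gram n F * X.rootElem n p α = X.gram n F := by
  obtain ⟨a, b⟩ := p
  rcases mem_posRoots.1 hp with ⟨hab, hba | ⟨hX, rfl⟩⟩
  · obtain ⟨β, γ, h, h₁, h₂, h₃⟩ := rootElem_of_up hF hab hba α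
    rw [h]
    exact preserves_of_singles hab hba h₁ h₂ h₃
  · rw [rootElem_of_antidiag hX]
    refine preserves_of_single hab ?_
    have ha := a.isLt
    rw [Fin.lt_def] at hab
    rw [Fin.val_rev] at hab
    subst hX
    simp only [size] at ha hab
    rw [gramSign, gramSign, if_neg (by omega),
      if_pos ⟨rfl, by rw [Fin.val_rev]; simp only [size]; omega⟩]
    ring

/-- The entries of a root subgroup element. -/
theorem rootElem_apply (hF : (2 : F) ≠ 0) {a b : X.Idx n} (hp : (a, b) ∈ X.posRoots n) (α : F) :
    X.rootElem n (a, b) α a b = α ∧ (∀ i, X.rootElem n (a, b) α i i = 1) ∧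
      ∀ c d, c ≠ d → X.rootElem n (a, b) α c d ≠ 0 → (c = a ∧ d = b) ∨ (c = b.rev ∧ d = a.rev) ∨
        (b = b.rev ∧ c = a ∧ d = a.rev) := by
  rcases mem_posRoots.1 hp with ⟨hab, hba | ⟨hX, rfl⟩⟩
  · obtain ⟨β, γ, h, h₁, h₂, h₃⟩ := rootElem_of_up hF hab hba α
    have e₁ : a ≠ a.rev := (hab.trans hba).ne
    have e₂ : a ≠ b := hab.ne
    have e₃ : b ≠ a.rev := hba.ne
    have e₄ : b.rev ≠ a := fun h => e₃ (by rw [← h, Fin.rev_rev])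
    have e₅ : b.rev ≠ a.rev := fun h => e₂ (Fin.rev_injective h).symm
    rw [h]
    refine ⟨?_, fun i => ?_, fun c d hcd => ?_⟩
    · simp [one_apply, e₂, e₃.symm, e₄]
    · have t₁ : ¬ (a = i ∧ b = i) := fun h => e₂ (h.1.trans h.2.symm)
      have t₂ : ¬ (b.rev = i ∧ a.rev = i) := fun h => e₅ (h.1.trans h.2.symm)
      have t₃ : ¬ (a = i ∧ a.rev = i) := fun h => e₁ (h.1.trans h.2.symm)
      simp [t₁, t₂, t₃]
    · intro hne
      by_contra hcon
      push Not at hcon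
      apply hne
      have t₁ : ¬ (a = c ∧ b = d) := fun h => hcon.1 h.1.symm h.2.symm
      have t₂ : ¬ (b.rev = c ∧ a.rev = d) := fun h => hcon.2.1 h.1.symm h.2.symm
      rcases h₃ with ⟨-, rfl⟩ | ⟨hb, -⟩
      · simp [t₁, t₂, one_apply, hcd]
      · have t₃ : ¬ (a = c ∧ a.rev = d) := fun h => hcon.2.2 hb h.1.symm h.2.symm
        simp [t₁, t₂, t₃, one_apply, hcd]
  · rw [rootElem_of_antidiag hX, Fin.rev_rev]
    have e₁ : a ≠ a.rev := hab.ne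
    refine ⟨?_, fun i => ?_, fun c d hcd => ?_⟩
    · simp [one_apply, e₁]
    · have t₃ : ¬ (a = i ∧ a.rev = i) := fun h => e₁ (h.1.trans h.2.symm)
      simp [t₃]
    · intro hne
      by_contra hcon
      push Not at hcon
      have t₁ : ¬ (a = c ∧ a.rev = d) := fun h => hcon.1 h.1.symm h.2.symm
      exact hne (by simp [t₁, one_apply, hcd])

theorem exists_rootElem_rev_apply (hF : (2 : F) ≠ 0) {a b : X.Idx n}
    (hp : (a, b) ∈ X.posRoots n) (α : F) :
    ∃ β, X.rootElem n (a, b) β b.rev a.rev = α := by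
  rcases mem_posRoots.1 hp with ⟨hab, hba | ⟨hX, rfl⟩⟩
  · have ha := gramSign_ne_zero (F := F) a
    have hb := gramSign_ne_zero (F := F) b
    -- The parameter that solves `h₁` for mirror entry `α`.
    obtain ⟨β, γ, h, h₁, -⟩ := rootElem_of_up hF hab hba (-(α * gramSign F b / gramSign F a))
    have e₄ : a ≠ b.rev := fun h => hba.ne (by rw [h, Fin.rev_rev])
    have e₅ : b.rev ≠ a.rev := fun h => hab.ne' (Fin.rev_injective h)
    refine ⟨_, (congrFun (congrFun h _) _).trans ?_⟩
    have hβ : β = α := by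
      field_simp at h₁
      exact mul_right_cancel₀ hb (by linear_combination h₁)
    simp [one_apply, e₄, e₅, hβ]
  · refine ⟨α, ?_⟩
    rw [rootElem_of_antidiag hX, Fin.rev_rev]
    simp [one_apply, hab.ne]

theorem rootElem_apply_of_gt (hF : (2 : F) ≠ 0) {p : X.Pos n} (hp : p ∈ X.posRoots n) (α : F)
    {c d : X.Idx n} (hdc : d < c) : X.rootElem n p α c d = 0 := by
  obtain ⟨a, b⟩ := p
  by_contra hne
  have hab := (mem_posRoots.1 hp).1
  have hba : b ≤ a.rev := by
    rcases (mem_posRoots.1 hp).2 with h | ⟨-, h⟩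
    exacts [h.le, h.le]
  rcases (rootElem_apply hF hp α).2.2 c d hdc.ne' hne with
    ⟨rfl, rfl⟩ | ⟨rfl, rfl⟩ | ⟨-, rfl, rfl⟩
  · exact lt_asymm hab hdc
  · exact lt_asymm (Fin.rev_lt_rev.2 hab) hdc
  · exact lt_asymm (hab.trans_le hba) hdc

theorem mem_sylowU_of_eq_rootElem (hF : (2 : F) ≠ 0) {p : X.Pos n} (hp : p ∈ X.posRoots n)
    {α : F} {g : GL (X.Idx n) F} (hg : g.val = X.rootElem n p α) : g ∈ X.sylowU n F := by
  refine ⟨?_, fun i j h => ?_, fun i => ?_⟩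
  · change g.valᵀ * X.gram n F * g.val = X.gram n F
    rw [hg]
    exact rootElem_preserves hF hp α
  · rw [hg]
    exact rootElem_apply_of_gt hF hp α h
  · rw [hg]
    exact (rootElem_apply hF hp α).2.1 i

theorem exists_eq_rootElem (hF : (2 : F) ≠ 0) {p : X.Pos n} (hp : p ∈ X.posRoots n) (α : F) :
    ∃ g : GL (X.Idx n) F, g.val = X.rootElem n p α := by
  have hdet : (X.rootElem n p α).det = 1 := by
    rw [det_of_isUpperTriangular (M := X.rootElem n p α)
      fun c d h => rootElem_apply_of_gt hF hp α h]
    exact Finset.prod_eq_one fun i _ => (rootElem_apply hF hp α).2.1 i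
  have hu : IsUnit (X.rootElem n p α) := by
    rw [isUnit_iff_isUnit_det, hdet]
    exact isUnit_one
  exact ⟨hu.unit, hu.unit_spec⟩

theorem patternSubgroup_le_sylowU (hF : (2 : F) ≠ 0) {J : Set (X.Pos n)}
    (hJ : J ⊆ X.posRoots n) : X.patternSubgroup n F J ≤ X.sylowU n F := by
  rw [patternSubgroup, Subgroup.closure_le]
  rintro g ⟨p, hp, α, hg⟩
  exact mem_sylowU_of_eq_rootElem hF (hJ hp) hg

/-- For every position `(m, j)` above the diagonal (off the antidiagonal unless in type `C_n`),
`U` has an element with any given entry there and few other nonzero entries off the diagonal. -/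
theorem exists_mem_sylowU_entry (hF : (2 : F) ≠ 0) {m j : X.Idx n} (hmj : m < j)
    (h : j ≠ m.rev ∨ X = C) (α : F) :
    ∃ g : GL (X.Idx n) F, g ∈ X.sylowU n F ∧ g.val m j = α ∧
      ∀ c d, c ≠ d → g.val c d ≠ 0 → (c = m ∧ d = j) ∨ (c = j.rev ∧ d = m.rev) ∨
        (j = j.rev ∧ c = m ∧ d = m.rev) ∨ (m = m.rev ∧ c = j.rev ∧ d = j) := by
  by_cases hp : (m, j) ∈ X.posRoots n
  · obtain ⟨g, hg⟩ := exists_eq_rootElem hF hp α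
    refine ⟨g, mem_sylowU_of_eq_rootElem hF hp hg, ?_, fun c d hcd hne => ?_⟩
    · rw [hg]; exact (rootElem_apply hF hp α).1
    · rw [hg] at hne
      rcases (rootElem_apply hF hp α).2.2 c d hcd hne with h | h | h
      exacts [Or.inl h, Or.inr (Or.inl h), Or.inr (Or.inr (Or.inl h))]
  -- A position beyond the antidiagonal is reached as the mirror entry of a root element.
  · have hp' : (j.rev, m.rev) ∈ X.posRoots n := by
      rw [mem_posRoots] at hp ⊢
      refine ⟨Fin.rev_lt_rev.2 hmj, Or.inl ?_⟩
      rw [Fin.rev_rev]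
      by_contra hle
      push Not at hp hle
      rcases h with h | h
      · exact absurd (lt_of_le_of_ne hle h) (not_lt.2 (hp hmj).1)
      · exact (hp hmj).2 h (le_antisymm hle (hp hmj).1)
    obtain ⟨β, hβ⟩ := exists_rootElem_rev_apply hF hp' α
    rw [Fin.rev_rev, Fin.rev_rev] at hβ
    obtain ⟨g, hg⟩ := exists_eq_rootElem hF hp' β
    refine ⟨g, mem_sylowU_of_eq_rootElem hF hp' hg, ?_, fun c d hcd hne => ?_⟩
    · rw [hg]; exact hβ
    · rw [hg] at hne
      rcases (rootElem_apply hF hp' β).2.2 c d hcd hne with h | h | h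
      · exact Or.inr (Or.inl h)
      · simp only [Fin.rev_rev] at h
        exact Or.inl h
      · simp only [Fin.rev_rev] at h
        exact Or.inr (Or.inr (Or.inr ⟨h.1.symm, h.2⟩))

end Groups

/-! ### The action of `U` on `V` and its invariants. -/

section Action

variable {F : Type*} [Field F]

theorem val_apply_eq_zero (A : X.V n F) {i j k : X.Idx n} (hij : i < j)
    (hj : (i, j) ∉ X.posRoots n) (hjk : j ≤ k) : A.val i k = 0 := by
  refine A.property i k fun h => hj ?_
  rw [mem_posRoots] at h ⊢
  refine ⟨hij, ?_⟩
  rcases h.2 with h | ⟨hX, h⟩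
  · exact Or.inl (hjk.trans_lt h)
  · rcases hjk.lt_or_eq with h' | h'
    · exact Or.inl (h ▸ h')
    · exact Or.inr ⟨hX, h' ▸ h⟩

theorem proj_apply {M : Matrix (X.Idx n) (X.Idx n) F} {i j : X.Idx n}
    (h : (i, j) ∈ X.posRoots n) : (X.proj n M).val i j = M i j := by
  simp [proj, h]

theorem V_ext {A B : X.V n F} (h : ∀ i j, (i, j) ∈ X.posRoots n → A.val i j = B.val i j) :
    A = B := by
  refine Subtype.ext (Matrix.ext fun i j => ?_)
  by_cases hp : (i, j) ∈ X.posRoots n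
  · exact h i j hp
  · rw [A.property i j hp, B.property i j hp]

theorem mul_transpose_apply {M : Matrix (X.Idx n) (X.Idx n) F} {g : GL (X.Idx n) F}
    (hg : g ∈ X.sylowU n F) {i j : X.Idx n} (h : ∀ k, j < k → M i k = 0) :
    (M * g.valᵀ) i j = M i j := by
  rw [Matrix.mul_apply, Finset.sum_eq_single j]
  · rw [transpose_apply, hg.2.2 j, mul_one]
  · intro k _ hk
    rcases lt_or_gt_of_ne hk with hk | hk
    · rw [transpose_apply, hg.2.1 j k hk, mul_zero]
    · rw [h k hk, zero_mul]
  · simp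

/-- What makes `π(A gᵗ)` an action: by `hM`, `π` discards only entries on or below the diagonal, and
since `gᵗ` moves entries leftwards these never reach a root of their row. -/
theorem proj_proj_mul_transpose (M : Matrix (X.Idx n) (X.Idx n) F) {g : GL (X.Idx n) F}
    (hg : g ∈ X.sylowU n F)
    (hM : ∀ i j, i < j → (i, j) ∉ X.posRoots n → M i j = 0) :
    X.proj n ((X.proj n M).val * g.valᵀ) = X.proj n (M * g.valᵀ) := by
  refine V_ext fun i j hp => ?_
  rw [proj_apply hp, proj_apply hp, Matrix.mul_apply, Matrix.mul_apply]
  refine Finset.sum_congr rfl fun k _ => ?_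
  rcases lt_or_ge k j with hk | hk
  · rw [transpose_apply, hg.2.1 j k hk, mul_zero, mul_zero]
  · by_cases hp' : (i, k) ∈ X.posRoots n
    · rw [proj_apply hp']
    · rw [(X.proj n M).property i k hp', hM i k ((mem_posRoots.1 hp).1.trans_le hk) hp']

theorem mul_transpose_apply_eq_zero (A : X.V n F) {g : GL (X.Idx n) F} (hg : g ∈ X.sylowU n F)
    {i j : X.Idx n} (hij : i < j) (hp : (i, j) ∉ X.posRoots n) : (A.val * g.valᵀ) i j = 0 := by
  rw [mul_transpose_apply hg fun k hk => val_apply_eq_zero A hij hp hk.le]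
  exact A.property i j hp

/-- The left action `g • A = π(A gᵗ)` of `U` on `V`. -/
instance : MulAction (X.sylowU n F) (X.V n F) where
  smul g A := X.proj n (A.val * g.val.valᵀ)
  one_smul A := by
    refine V_ext fun i j hp => ?_
    change (X.proj n (A.val * (1 : Matrix (X.Idx n) (X.Idx n) F)ᵀ)).val i j = _
    rw [proj_apply hp, transpose_one, mul_one]
  mul_smul g h A := by
    change X.proj n (A.val * (g.val.val * h.val.val)ᵀ) =
      X.proj n ((X.proj n (A.val * h.val.valᵀ)).val * g.val.valᵀ)
    rw [proj_proj_mul_transpose _ g.2, transpose_mul, Matrix.mul_assoc]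
    exact fun i j hij hp => mul_transpose_apply_eq_zero A h.2 hij hp

theorem smul_def (g : X.sylowU n F) (A : X.V n F) :
    g • A = X.proj n (A.val * g.val.valᵀ) := rfl

theorem smul_apply (g : X.sylowU n F) (A : X.V n F) {i j : X.Idx n}
    (h : (i, j) ∈ X.posRoots n) : (g • A).val i j = (A.val * g.val.valᵀ) i j :=
  proj_apply h

/-- Right multiplication by `u⁻¹` and by its transpose are adjoint for the trace form; both
projections drop out because the other factor is supported on the roots. -/
theorem actChar_bracket (θ : AddChar F ℂ) (A : X.V n F) (u : GL (X.Idx n) F) :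
    actChar (bracket θ A) u = bracket θ (X.proj n (A.val * (u⁻¹).valᵀ)) := by
  ext B
  change θ (trace ((-A).valᵀ * (X.proj n (B.val * (u⁻¹).val)).val)) =
    θ (trace ((-X.proj n (A.val * (u⁻¹).valᵀ)).valᵀ * B.val))
  congr 1
  have h₁ : trace ((-A).valᵀ * (X.proj n (B.val * (u⁻¹).val)).val) =
      trace ((-A).valᵀ * (B.val * (u⁻¹).val)) := by
    simp only [trace, diag, Matrix.mul_apply (M := (-A).valᵀ), transpose_apply]
    refine Finset.sum_congr rfl fun i _ => Finset.sum_congr rfl fun j _ => ?_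
    by_cases hp : (j, i) ∈ X.posRoots n
    · rw [proj_apply hp]
    · rw [(-A).property j i hp, zero_mul, zero_mul]
  have h₂ : trace ((-X.proj n (A.val * (u⁻¹).valᵀ)).valᵀ * B.val) =
      trace ((-(A.val * (u⁻¹).valᵀ))ᵀ * B.val) := by
    simp only [trace, diag, Matrix.mul_apply (N := B.val), transpose_apply]
    refine Finset.sum_congr rfl fun i _ => Finset.sum_congr rfl fun j _ => ?_
    by_cases hp : (j, i) ∈ X.posRoots n
    · rw [Submodule.coe_neg, neg_apply, neg_apply, proj_apply hp]
    · rw [B.property j i hp, mul_zero, mul_zero]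
  rw [h₁, h₂, Submodule.coe_neg, transpose_neg, transpose_neg, transpose_mul, transpose_transpose,
    neg_mul, neg_mul, trace_neg, trace_neg, ← Matrix.mul_assoc, trace_mul_comm, Matrix.mul_assoc]

theorem orbit_eq_image (θ : AddChar F ℂ) (A : X.V n F) :
    orbit θ A = bracket θ '' MulAction.orbit (X.sylowU n F) A := by
  ext χ
  constructor
  · rintro ⟨u, hu, rfl⟩
    exact ⟨(⟨u, hu⟩ : X.sylowU n F)⁻¹ • A, ⟨_, rfl⟩, (actChar_bracket θ A u).symm⟩
  · rintro ⟨_, ⟨g, rfl⟩, rfl⟩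
    refine ⟨(g⁻¹).val, (g⁻¹).2, ?_⟩
    rw [actChar_bracket]
    simp [smul_def]

theorem bracket_injective {θ : AddChar F ℂ} (hθ : θ ≠ 1) :
    Function.Injective (bracket θ : X.V n F → _) := by
  intro A B h
  refine V_ext fun i j hp => ?_
  by_contra hne
  refine hθ ?_
  have hne' : B.val i j - A.val i j ≠ 0 := sub_ne_zero.2 (Ne.symm hne)
  ext t
  -- Scaled so that the two linear forms differ by exactly `t` on this matrix unit, which forces `θ
  -- t = 1`.
  have hE : single i j (t / (B.val i j - A.val i j)) ∈ X.V n F := by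
    intro a b hab
    rw [single_apply, if_neg]
    rintro ⟨rfl, rfl⟩
    exact hab hp
  have hτ : ∀ (A : X.V n F) (t : F) (hE : single i j t ∈ X.V n F),
      tau A ⟨single i j t, hE⟩ = A.val i j * t := by
    intro A t hE
    change trace (A.valᵀ * single i j t) = _
    simp [trace_mul_single]
  have h' := DFunLike.congr_fun h ⟨_, hE⟩
  change θ (tau (-A) _) = θ (tau (-B) _) at h'
  rw [hτ, hτ] at h'
  have e : t = (-A).val i j * (t / (B.val i j - A.val i j)) -
      (-B).val i j * (t / (B.val i j - A.val i j)) := by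
    rw [Submodule.coe_neg, Submodule.coe_neg, neg_apply, neg_apply]
    field_simp
    ring
  rw [e, AddChar.map_sub_eq_div, h', AddChar.one_apply, div_self]
  exact (AddChar.val_isUnit _ _).ne_zero

/-- Multiplying by `gᵗ` changes an entry only by multiples of entries to its right, so the rightmost
nonzero entry of a row survives unchanged. -/
theorem mainConds_subset_smul (g : X.sylowU n F) (A : X.V n F) :
    mainConds A ⊆ mainConds (g • A) := by
  rintro ⟨i, j⟩ ⟨hp, hne, hz⟩
  refine ⟨hp, ?_, fun k hk => ?_⟩
  · rwa [smul_apply _ _ hp, mul_transpose_apply g.2 hz]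
  · by_cases hp' : (i, k) ∈ X.posRoots n
    · rw [smul_apply _ _ hp', mul_transpose_apply g.2 fun l hl => hz l (hk.trans hl)]
      exact hz k hk
    · exact (g • A).property i k hp'

theorem mainConds_smul (g : X.sylowU n F) (A : X.V n F) : mainConds (g • A) = mainConds A := by
  refine (mainConds_subset_smul g A).antisymm' ?_
  have := mainConds_subset_smul g⁻¹ (g • A)
  rwa [inv_smul_smul] at this

theorem mainConds_of_mem_orbit {A B : X.V n F} (h : B ∈ MulAction.orbit (X.sylowU n F) A) :
    mainConds B = mainConds A := by
  obtain ⟨g, rfl⟩ := h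
  exact mainConds_smul g A

theorem core_congr {A B : X.V n F} (h : mainConds A = mainConds B) : core A = core B := by
  simp only [core, supplConds, minorConds, rightMain, leftMain, h]

theorem places_congr {A B : X.V n F} (h : mainConds A = mainConds B) : places A = places B := by
  simp only [places, core_congr h, h]

theorem limb_congr {A B : X.V n F} (h : mainConds A = mainConds B) : limb A = limb B := by
  simp only [limb, h]

theorem isStaircase_congr {A B : X.V n F} (h : mainConds A = mainConds B) :
    IsStaircase A ↔ IsStaircase B := by
  simp only [IsStaircase, h]

theorem mainConds_verge (A : X.V n F) : mainConds (verge A) = mainConds A := by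
  have hv : ∀ i j, (i, j) ∈ mainConds A → (verge A).val i j = A.val i j := fun i j h => by
    simp [verge, h]
  have hv' : ∀ i j, (i, j) ∉ mainConds A → (verge A).val i j = 0 := fun i j h => by
    simp [verge, h]
  ext ⟨i, j⟩
  constructor
  · rintro ⟨-, hne, -⟩
    by_contra h
    exact hne (hv' i j h)
  · intro h
    refine ⟨h.1, ?_, fun k hk => hv' i k fun hm => hm.2.1 (h.2.2 k hk)⟩
    rw [hv i j h]
    exact h.2.1

theorem exists_mainCond (A : X.V n F) {i j : X.Idx n} (h : A.val i j ≠ 0) :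
    ∃ k, j ≤ k ∧ (i, k) ∈ mainConds A := by
  classical
  obtain ⟨k, hk, hmax⟩ := (Finset.univ.filter fun k => A.val i k ≠ 0).exists_max_image id
    ⟨j, by simp [h]⟩
  rw [Finset.mem_filter] at hk
  refine ⟨k, hmax j (by simp [h]), ?_, hk.2, fun l hl => ?_⟩
  · by_contra hp
    exact hk.2 (A.property i k hp)
  · by_contra hne
    exact absurd (hmax l (by simp [hne])) (not_le.2 hl)

theorem mainCond_unique {A : X.V n F} {i j k : X.Idx n} (hj : (i, j) ∈ mainConds A)
    (hk : (i, k) ∈ mainConds A) : j = k := by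
  rcases lt_trichotomy j k with h | h | h
  · exact absurd (hj.2.2 k h) hk.2.1
  · exact h
  · exact absurd (hk.2.2 j h) hj.2.1

theorem mem_minorConds {A : X.V n F} {i j : X.Idx n} :
    (i, j) ∈ minorConds A ↔ (i, j.rev) ∈ mainConds A ∧ j < j.rev := by
  simp only [minorConds, rightMain, Set.mem_ofPred_eq, Set.mem_inter_iff, mem_rightPart,
    Fin.rev_rev]
  exact ⟨fun h => ⟨h.1, h.2.2⟩, fun h => ⟨h.1, h.1.1, h.2⟩⟩

/-- A left main condition `(k, j)` bounds `m` by `j`, a right one by the minor column `j̄`; in both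
cases the bound is the smaller of the two. The staircase property turns "not minor" into `i ≠ k`. -/
theorem mem_supplConds {A : X.V n F} (hA : IsStaircase A) {k m : X.Idx n} :
    (k, m) ∈ supplConds A ↔ (k, m) ∈ X.posRoots n ∧ m < m.rev ∧ ∃ i j,
      (i, m.rev) ∈ mainConds A ∧ (k, j) ∈ mainConds A ∧ i ≠ k ∧ m < j ∧ m < j.rev := by
  constructor
  · rintro ⟨hl, ⟨⟨k', j⟩, hr, hk, hmj⟩, ⟨⟨i, m'⟩, hi, rfl : m' = m⟩, hmin, hmain⟩
    obtain rfl : k = k' := hk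
    replace hmj : m' < j := hmj
    rw [mem_minorConds] at hi
    have hik : i ≠ k := by
      rintro rfl
      exact hmin (mem_minorConds.2 hi)
    refine ⟨hl.1, hi.2, ?_⟩
    rcases hr with hr | hr
    · rw [mem_minorConds] at hr
      exact ⟨i, j.rev, hi.1, hr.1, hik, hmj.trans hr.2, by rwa [Fin.rev_rev]⟩
    · exact ⟨i, j, hi.1, hr.1, hik, hmj, hmj.trans_le (mem_leftPart.1 hr.2).2⟩
  · rintro ⟨hp, hm, i, j, hi, hk, hik, hmj, hmj'⟩
    refine ⟨mem_leftPart.2 ⟨hp, hm.le⟩, ?_, ⟨(i, m), mem_minorConds.2 ⟨hi, hm⟩, rfl⟩, ?_, ?_⟩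
    · rcases le_or_gt j j.rev with h | h
      · exact ⟨(k, j), Or.inr ⟨hk, mem_leftPart.2 ⟨hk.1, h⟩⟩, rfl, hmj⟩
      · refine ⟨(k, j.rev), Or.inl (mem_minorConds.2 ?_), rfl, hmj'⟩
        rw [Fin.rev_rev]
        exact ⟨hk, h⟩
    · intro h
      exact hik (congrArg Prod.fst (hA hi (mem_minorConds.1 h).1 rfl))
    · intro h
      exact hmj.ne (mainCond_unique h hk)

theorem mem_core {A : X.V n F} {p : X.Pos n} : p ∈ core A ↔
    p ∈ mainConds A ∨ (X ≠ C ∧ p ∈ minorConds A) ∨ p ∈ supplConds A := Iff.rfl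

/-- The rows of `A gᵗ` have the same Gram matrix for all `g` in `U`. -/
theorem sum_gramSign_mul (A : X.V n F) (g h : X.sylowU n F) (i k : X.Idx n) :
    ∑ d, (A.val * g.val.valᵀ) i d * gramSign F d * (A.val * g.val.valᵀ) k d.rev =
      ∑ d, (A.val * h.val.valᵀ) i d * gramSign F d * (A.val * h.val.valᵀ) k d.rev := by
  have key : ∀ g : X.sylowU n F,
      ∑ d, (A.val * g.val.valᵀ) i d * gramSign F d * (A.val * g.val.valᵀ) k d.rev =
        (A.val * X.gram n F * A.valᵀ) i k := by
    intro g
    have hg : g.val.valᵀ * X.gram n F * g.val.val = X.gram n F := g.2.1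
    have e : A.val * X.gram n F * A.valᵀ =
        (A.val * g.val.valᵀ) * (X.gram n F * (A.val * g.val.valᵀ)ᵀ) := by
      conv_lhs => rw [← hg]
      simp only [transpose_mul, transpose_transpose, Matrix.mul_assoc]
    rw [e, Matrix.mul_apply]
    exact Finset.sum_congr rfl fun d _ => by rw [gram_mul_apply, transpose_apply, mul_assoc]
  rw [key, key]

end Action

/-! ### Places as coordinates on a staircase orbit. -/

section Orbit

variable {F : Type*} [Field F]

theorem add_eq_add_of_sum_eq {ι M : Type*} [Fintype ι] [DecidableEq ι] [AddCommGroup M]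
    {f g : ι → M} (h : ∑ d, f d = ∑ d, g d) {a b : ι} (hab : a ≠ b)
    (hfg : ∀ d, d ≠ a → d ≠ b → f d = g d) : f a + f b = g a + g b := by
  have h' : ∑ d, (f d - g d) = 0 := by rw [Finset.sum_sub_distrib, h, sub_self]
  rw [Finset.sum_eq_add a b hab (fun d _ hd => sub_eq_zero.2 (hfg d hd.1 hd.2)) (by simp)
    (by simp)] at h'
  rw [← sub_eq_zero, ← h']
  abel

theorem eq_of_sum_eq {ι M : Type*} [Fintype ι] [DecidableEq ι] [AddCommGroup M]
    {f g : ι → M} (h : ∑ d, f d = ∑ d, g d) {a : ι} (hfg : ∀ d, d ≠ a → f d = g d) :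
    f a = g a := by
  have h' : ∑ d, (f d - g d) = 0 := by rw [Finset.sum_sub_distrib, h, sub_self]
  rw [Finset.sum_eq_single a (fun d _ hd => sub_eq_zero.2 (hfg d hd)) (by simp)] at h'
  exact sub_eq_zero.1 h'

/-- An element of a staircase orbit is determined by its entries at the places. -/
theorem smul_eq_smul_of_places (hF : (2 : F) ≠ 0) {A : X.V n F} (hA : IsStaircase A)
    {g h : X.sylowU n F}
    (hgh : ∀ k m, (k, m) ∈ places A → (g • A).val k m = (h • A).val k m) : g • A = h • A := by
  -- The unprojected products are compared, since the Gram invariant is stated for them; the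
  -- induction runs over columns from right to left.
  suffices key : ∀ m k, k < m → (A.val * g.val.valᵀ) k m = (A.val * h.val.valᵀ) k m by
    refine V_ext fun i j hp => ?_
    rw [smul_apply _ _ hp, smul_apply _ _ hp]
    exact key j i (mem_posRoots.1 hp).1
  have hzero : ∀ (g : X.sylowU n F) {i j d : X.Idx n}, (i, j) ∈ mainConds A → j < d →
      (A.val * g.val.valᵀ) i d = 0 := fun g i j d hm hd => by
    rw [mul_transpose_apply g.2 fun l hl => hm.2.2 l (hd.trans hl)]
    exact hm.2.2 d hd
  have hval : ∀ (g : X.sylowU n F) {i j : X.Idx n}, (i, j) ∈ mainConds A →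
      (A.val * g.val.valᵀ) i j = A.val i j := fun g i j hm => mul_transpose_apply g.2 hm.2.2
  intro m
  induction m using WellFoundedGT.induction with
  | _ m ih =>
  intro k hkm
  by_cases hp : (k, m) ∈ X.posRoots n
  swap
  · rw [mul_transpose_apply_eq_zero A g.2 hkm hp, mul_transpose_apply_eq_zero A h.2 hkm hp]
  by_cases hright : ∀ d, m < d → A.val k d = 0
  · rw [mul_transpose_apply g.2 hright, mul_transpose_apply h.2 hright]
  push Not at hright
  obtain ⟨d₀, hd₀, hne⟩ := hright
  obtain ⟨j, hj, hmain⟩ := exists_mainCond A hne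
  have hmj : m < j := hd₀.trans_le hj
  by_cases hcore : (k, m) ∈ core A
  swap
  · have := hgh k m ⟨hp, hcore, (k, j), hmain, rfl, hmj⟩
    rwa [smul_apply _ _ hp, smul_apply _ _ hp] at this
  rcases mem_core.1 hcore with h₁ | ⟨hX, h₁⟩ | h₁
  · exact absurd (mainCond_unique h₁ hmain) hmj.ne
  · obtain ⟨h₁, hm⟩ := mem_minorConds.1 h₁
    have hsum := sum_gramSign_mul A g h k k
    -- Row `k` paired with itself: apart from `m` and `m̄`, every term vanishes beyond the main
    -- column `m̄` or has both columns already known. The two remaining terms coincide, whence the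
    -- factor 2.
    have := add_eq_add_of_sum_eq hsum hm.ne fun d hd hd' => by
      rcases lt_or_gt_of_ne hd with hlt | hlt
      · have hlt' := Fin.rev_lt_rev.2 hlt
        rw [hzero g h₁ hlt', hzero h h₁ hlt', mul_zero, mul_zero]
      · rcases lt_or_gt_of_ne hd' with hlt' | hlt'
        · have hdm : m < d.rev := Fin.lt_rev_iff.2 hlt'
          rw [ih d hlt k (hkm.trans hlt), ih d.rev hdm k (hkm.trans hdm)]
        · rw [hzero g h₁ hlt', hzero h h₁ hlt', zero_mul, zero_mul, zero_mul]
    simp only [Fin.rev_rev, hval _ h₁, gramSign_of_ne_C hX, mul_one] at this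
    have h2 : 2 * A.val k m.rev ≠ 0 := mul_ne_zero hF h₁.2.1
    refine mul_left_cancel₀ h2 ?_
    linear_combination this
  · obtain ⟨-, hm, i, j', hi, hj', -, hmj, hmj'⟩ := (mem_supplConds hA).1 h₁
    have him : i ≤ m := by
      rw [← Fin.rev_le_rev]
      rcases (mem_posRoots.1 hi.1).2 with h | ⟨-, h⟩
      exacts [h.le, h.le]
    -- Row `i`, with main column `m̄`, paired with row `k`: the unknown entry occurs only at `d =
    -- m̄`, multiplied by the main entry of row `i`. The bound `m < j̄'` keeps the other columns of
    -- row `i` that matter in the known range.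
    have := eq_of_sum_eq (sum_gramSign_mul A g h i k) (a := m.rev) fun d hd => by
      rcases lt_or_gt_of_ne hd with hlt | hlt
      · have hdm : m < d.rev := Fin.lt_rev_iff.2 hlt
        rcases le_or_gt d.rev j' with hle | hle
        · have hd' : m < d := hmj'.trans_le (Fin.rev_le_iff.1 hle)
          rw [ih d hd' i (him.trans_lt hd'), ih d.rev hdm k (hkm.trans hdm)]
        · rw [hzero g hj' hle, hzero h hj' hle, mul_zero, mul_zero]
      · rw [hzero g hi hlt, hzero h hi hlt, zero_mul, zero_mul, zero_mul]
    simp only [Fin.rev_rev, hval _ hi] at this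
    exact mul_left_cancel₀ (mul_ne_zero hi.2.1 (gramSign_ne_zero _)) this

theorem lex_of_key_lt {N a r b s : ℕ} (hs : s < N) (h : a * N + r < b * N + s) :
    a < b ∨ (a = b ∧ r < s) := by
  rcases lt_trichotomy a b with h' | h' | h'
  · exact Or.inl h'
  · subst h'
    exact Or.inr ⟨rfl, by omega⟩
  · have := Nat.mul_le_mul_right N (Nat.succ_le_of_lt h')
    rw [Nat.succ_mul] at this
    omega

/-- The entry at one place can be given any value without changing the entries at places whose
main condition is further left, or to the right in the same row. -/
theorem exists_smul_entry (hF : (2 : F) ≠ 0) {A : X.V n F} (hA : IsStaircase A)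
    {k m j : X.Idx n} (hj : (k, j) ∈ mainConds A) (hm : (k, m) ∈ places A) (t : F) :
    ∃ g : X.sylowU n F, (g • A).val k m = t ∧
      ∀ k' m' j', (k', j') ∈ mainConds A → (k', m') ∈ places A →
        j' < j ∨ (j' = j ∧ m < m') → (g • A).val k' m' = A.val k' m' := by
  obtain ⟨hp, hcore, ⟨r₁, r₂⟩, hr, hk, hmj⟩ := hm
  obtain rfl : k = r₁ := hk
  obtain rfl : r₂ = j := mainCond_unique hr hj
  replace hmj : m < r₂ := hmj
  have hX : r₂ ≠ m.rev ∨ X = C := by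
    by_contra hcon
    push Not at hcon
    refine hcore (Or.inr (Or.inl ⟨hcon.2, mem_minorConds.2 ?_⟩))
    rw [← hcon.1]
    exact ⟨hj, hmj⟩
  -- The entry at `(k, m)` changes by `A k j` times the entry of `g` at `(m, j)`. The antidiagonal
  -- case is harmless: outside type C it would make `(k, m)` a minor condition.
  obtain ⟨g, hg, hgα, hsupp⟩ := exists_mem_sylowU_entry hF hmj hX
    ((t - A.val k m) / A.val k r₂)
  refine ⟨⟨g, hg⟩, ?_, fun k' m' j' hj' hm' hlt => ?_⟩
  · rw [smul_apply _ _ hp, Matrix.mul_apply, Finset.sum_eq_add m r₂ hmj.ne ?_ (by simp) (by simp)]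
    · have := hj.2.1
      simp only [transpose_apply, hg.2.2 m, hgα]
      field_simp
      ring
    · intro d _ hd
      by_contra hne
      rw [transpose_apply] at hne
      have h₁ := left_ne_zero_of_mul hne
      rcases hsupp m d hd.1.symm (right_ne_zero_of_mul hne) with h | h | h | h
      · exact hd.2 h.2
      · exact hd.2 (by rw [h.2, h.1, Fin.rev_rev])
      · refine h₁ (hj.2.2 d ?_)
        rw [h.2.2, h.1]
        exact Fin.rev_lt_rev.2 hmj
      · exact hd.2 h.2.2
  · rw [smul_apply _ _ hm'.1, Matrix.mul_apply, Finset.sum_eq_single m' ?_ (by simp)]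
    · rw [transpose_apply, hg.2.2 m', mul_one]
    · intro d _ hd
      by_contra hne
      rw [transpose_apply] at hne
      have hdj : d ≤ j' := by
        by_contra h
        exact left_ne_zero_of_mul hne (hj'.2.2 d (not_le.1 h))
      rcases hsupp m' d hd.symm (right_ne_zero_of_mul hne) with h | h | h | h
      · obtain ⟨rfl, rfl⟩ := h
        rcases hlt with h | h
        · exact absurd hdj (not_le.2 h)
        · exact lt_irrefl _ h.2
      · obtain ⟨rfl, rfl⟩ := h
        rcases hlt with h | ⟨rfl, h⟩
        · have hmr : r₂.rev < m := Fin.rev_lt_iff.2 (hdj.trans_lt h)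
          refine hm'.2.1 (Or.inr (Or.inr ((mem_supplConds hA).2
            ⟨hm'.1, ?_, k, j', ?_, hj', ?_, ?_, ?_⟩)))
          · rw [Fin.rev_rev]; exact hmr.trans hmj
          · rw [Fin.rev_rev]; exact hj
          · rintro rfl
            exact h.ne (mainCond_unique hj' hj)
          · exact (Fin.rev_lt_rev.2 hmj).trans_le hdj
          · exact Fin.rev_lt_rev.2 h
        · exact absurd hdj (not_le.2 (Fin.lt_rev_iff.1 h))
      · obtain ⟨h, rfl, rfl⟩ := h
        have : j' ≤ r₂ := by
          rcases hlt with h | h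
          exacts [h.le, h.1.le]
        rw [h] at this
        exact absurd hmj (not_lt.2 (Fin.rev_le_rev.1 (hdj.trans this)))
      · obtain ⟨h, rfl, rfl⟩ := h
        rcases hlt with h' | ⟨rfl, h'⟩
        · exact absurd hdj (not_le.2 h')
        · rw [h] at h'
          exact lt_asymm hmj (Fin.rev_lt_rev.1 h')

theorem exists_smul_places (hF : (2 : F) ≠ 0) {A : X.V n F} (hA : IsStaircase A)
    (Λ : X.Idx n → X.Idx n → F) :
    ∃ g : X.sylowU n F, ∀ k m, (k, m) ∈ places A → (g • A).val k m = Λ k m := by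
  -- The number `j * N + m̄` encodes the lexicographic order: main column ascending, then the
  -- columns of the row from right to left. In a staircase distinct places have distinct keys, as
  -- the main column determines the row.
  suffices key : ∀ t : ℕ, ∃ g : X.sylowU n F, ∀ k m j, (k, j) ∈ mainConds A →
      (k, m) ∈ places A → (j : ℕ) * X.size n + m.rev < t → (g • A).val k m = Λ k m by
    obtain ⟨g, hg⟩ := key (X.size n * X.size n)
    refine ⟨g, fun k m hm => ?_⟩
    obtain ⟨-, -, ⟨r₁, j⟩, hr, hk, -⟩ := id hm
    obtain rfl : k = r₁ := hk
    refine hg k m j hr hm ?_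
    have := Nat.mul_le_mul_right (X.size n) (Nat.succ_le_of_lt j.isLt)
    rw [Nat.succ_mul] at this
    have := m.rev.isLt
    omega
  intro t
  induction t with
  | zero => exact ⟨1, fun _ _ _ _ _ h => absurd h (Nat.not_lt_zero _)⟩
  | succ t ih =>
    obtain ⟨g, hg⟩ := ih
    by_cases hex : ∃ k m j, (k, j) ∈ mainConds A ∧ (k, m) ∈ places A ∧
        (j : ℕ) * X.size n + m.rev = t
    · obtain ⟨k, m, j, hj, hm, rfl⟩ := hex
      have hmain := mainConds_smul g A
      obtain ⟨u, hu, hu'⟩ := exists_smul_entry hF ((isStaircase_congr hmain).2 hA)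
        (hmain ▸ hj) ((places_congr hmain).symm ▸ hm) (Λ k m)
      refine ⟨u * g, fun k' m' j' hj' hm' hlt => ?_⟩
      rw [mul_smul]
      rcases Nat.lt_succ_iff_lt_or_eq.1 hlt with hlt | heq
      · rw [← hg k' m' j' hj' hm' hlt]
        refine hu' k' m' j' (hmain ▸ hj') ((places_congr hmain).symm ▸ hm') ?_
        rcases lex_of_key_lt m.rev.isLt hlt with h | ⟨h, h'⟩
        · exact Or.inl h
        · exact Or.inr ⟨Fin.ext h, Fin.rev_lt_rev.1 h'⟩
      · have hjj : (j' : ℕ) = j := by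
          rcases lt_trichotomy (j' : ℕ) j with h | h | h
          · have := Nat.mul_le_mul_right (X.size n) (Nat.succ_le_of_lt h)
            rw [Nat.succ_mul] at this
            have := m'.rev.isLt
            omega
          · exact h
          · have := Nat.mul_le_mul_right (X.size n) (Nat.succ_le_of_lt h)
            rw [Nat.succ_mul] at this
            have := m.rev.isLt
            omega
        rw [hjj] at heq
        obtain rfl : m' = m := Fin.rev_injective (Fin.ext (by omega))
        obtain rfl : k' = k := congrArg Prod.fst (hA hj' hj (Fin.ext hjj))
        exact hu
    · push Not at hex
      refine ⟨g, fun k m j hj hm hlt => ?_⟩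
      rcases Nat.lt_succ_iff_lt_or_eq.1 hlt with hlt | heq
      · exact hg k m j hj hm hlt
      · exact absurd heq (hex k m j hj hm)

end Orbit

/-! ### The bijection between places and limbs. -/

section Places

variable {F : Type*} [Field F]

theorem posRoots_of_le {i j k : X.Idx n} (h : (i, k) ∈ X.posRoots n) (hij : i < j)
    (hjk : j ≤ k) : (i, j) ∈ X.posRoots n := by
  by_contra hp
  rw [mem_posRoots] at h hp
  push Not at hp
  obtain ⟨h₁, h₂⟩ := hp hij
  rcases h.2 with h' | ⟨hX, h'⟩
  · exact absurd (hjk.trans_lt h') (not_lt.2 h₁)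
  · exact h₂ hX (le_antisymm (h' ▸ hjk) h₁)

theorem le_rev_of_mem_posRoots {i j : X.Idx n} (h : (i, j) ∈ X.posRoots n) : j ≤ i.rev := by
  rcases (mem_posRoots.1 h).2 with h | ⟨-, h⟩
  exacts [h.le, h.le]

theorem mem_places {A : X.V n F} (hA : IsStaircase A) {k m j : X.Idx n}
    (hj : (k, j) ∈ mainConds A) :
    (k, m) ∈ places A ↔ k < m ∧ m < j ∧ (m.rev = j → X = C) ∧
      ∀ i, (i, m.rev) ∈ mainConds A → i ≠ k → m < m.rev → j.rev ≤ m := by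
  constructor
  · rintro ⟨hp, hcore, ⟨r₁, r₂⟩, hr, hk, hmj⟩
    obtain rfl : k = r₁ := hk
    obtain rfl : r₂ = j := mainCond_unique hr hj
    replace hmj : m < r₂ := hmj
    refine ⟨(mem_posRoots.1 hp).1, hmj, fun h => ?_, fun i hi hik hm => ?_⟩
    · by_contra hX
      exact hcore (Or.inr (Or.inl ⟨hX, mem_minorConds.2 ⟨h ▸ hj, h ▸ hmj⟩⟩))
    · by_contra hlt
      exact hcore (Or.inr (Or.inr ((mem_supplConds hA).2
        ⟨hp, hm, i, r₂, hi, hj, hik, hmj, not_le.1 hlt⟩)))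
  · rintro ⟨hkm, hmj, hX, hs⟩
    have hp := posRoots_of_le hj.1 hkm hmj.le
    refine ⟨hp, ?_, (k, j), hj, rfl, hmj⟩
    rintro (h | ⟨hX', h⟩ | h)
    · exact hmj.ne (mainCond_unique h hj)
    · exact hX' (hX (mainCond_unique (mem_minorConds.1 h).1 hj))
    · obtain ⟨-, hm, i, j', hi, hj', hik, -, hmj'⟩ := (mem_supplConds hA).1 h
      obtain rfl := mainCond_unique hj hj'
      exact absurd hmj' (not_lt.2 (hs i hi hik hm))

/-- The bound `i < b̄` is automatic off the antidiagonal and cuts the arm down to `up` on it. Thus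
the arm mirrors the positions `(b̄, j)` with `i < b̄ < j`, continuing the leg past the antidiagonal.
-/
theorem mem_arm {i j a b : X.Idx n} (h : (i, j) ∈ X.posRoots n) :
    (a, b) ∈ arm (i, j) ↔ a = j.rev ∧ (a, b) ∈ X.posRoots n ∧ i < b.rev := by
  constructor
  · rintro (⟨h₁, h₂, h₃⟩ | ⟨h₁, h₂, h₃⟩)
    · obtain rfl : a = j.rev := h₃
      exact ⟨rfl, h₂, Fin.lt_rev_iff.2
        ((le_rev_of_mem_posRoots h₂).trans_lt (by rw [Fin.rev_rev]; exact h₁.2))⟩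
    · obtain rfl : a = i := h₃
      exact ⟨h₁.2, Or.inl h₂, Fin.lt_rev_iff.2 h₂.2⟩
  · rintro ⟨rfl, h₂, h₃⟩
    rcases h with h | ⟨hX, h⟩
    · exact Or.inl ⟨h, h₂, rfl⟩
    · obtain rfl : i = j.rev := h.2
      exact Or.inr ⟨h, ⟨(mem_posRoots.1 h₂).1, Fin.lt_rev_iff.1 h₃⟩, rfl⟩

open Classical in
/-- The position of `(i, j)` and its mirror image `(j̄, ī)` that is a positive root. -/
def fold (p : X.Pos n) : X.Pos n := if p ∈ X.posRoots n then p else (p.2.rev, p.1.rev)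

theorem fold_of_mem {p : X.Pos n} (h : p ∈ X.posRoots n) : fold p = p := if_pos h

theorem fold_of_notMem {p : X.Pos n} (h : p ∉ X.posRoots n) : fold p = (p.2.rev, p.1.rev) :=
  if_neg h

/-- The map sends `(k, m)` to the root among `(m, j)` and its mirror image, `j` being the main
column of row `k`. Legs and arms may overlap; the supplementary conditions remove exactly the double
counting. -/
theorem ncard_places_eq_ncard_limb {A : X.V n F} (hA : IsStaircase A) :
    (places A).ncard = (limb A).ncard := by
  have hex : ∀ k, ∃ j, ∀ j', (k, j') ∈ mainConds A → (k, j) ∈ mainConds A := fun k => by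
    by_cases h : ∃ j, (k, j) ∈ mainConds A
    · exact ⟨h.choose, fun _ _ => h.choose_spec⟩
    -- Junk value for a zero row, which contains no place.
    · exact ⟨k, fun j' hj' => absurd ⟨j', hj'⟩ h⟩
  choose c hc using hex
  have hc' : ∀ {k j}, (k, j) ∈ mainConds A → c k = j := fun {k j} hj =>
    mainCond_unique (hc k j hj) hj
  have hplace : ∀ {k m}, (k, m) ∈ places A → (k, c k) ∈ mainConds A := by
    rintro k m ⟨-, -, ⟨r₁, r₂⟩, hr, hk, -⟩
    obtain rfl : k = r₁ := hk
    exact hc k r₂ hr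
  have hnot : ∀ {k m}, (k, m) ∈ places A → (m, c k) ∉ X.posRoots n → m.rev < c k := by
    intro k m hm hp
    obtain ⟨-, hmj, hX, -⟩ := (mem_places hA (hplace hm)).1 hm
    rw [mem_posRoots] at hp
    push Not at hp
    obtain ⟨h₁, h₂⟩ := hp hmj
    exact lt_of_le_of_ne h₁ fun h => h₂ (hX h) h.symm
  -- An unfolded and a folded image cannot agree: `(k, m)` would be supplementary.
  have hinj : ∀ {k m k' m'}, (k, m) ∈ places A → (k', m') ∈ places A →
      (m', c k') ∉ X.posRoots n → m = (c k').rev → c k = m'.rev → False := by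
    intro k m k' m' hm hm' hp' h₁ h₂
    have hj := hplace hm
    have hj' := hplace hm'
    obtain ⟨-, hmj, -, hs⟩ := (mem_places hA hj).1 hm
    obtain ⟨-, hmj', -, -⟩ := (mem_places hA hj').1 hm'
    have hlt := hnot hm' hp'
    have hr : m.rev = c k' := by rw [h₁, Fin.rev_rev]
    have hkk : k' ≠ k := by
      rintro rfl
      exact hlt.ne h₂.symm
    have := hs k' (hr ▸ hj') hkk (by rw [hr, h₁]; exact (Fin.rev_lt_iff.2 hlt).trans hmj')
    rw [h₁, Fin.rev_le_rev, h₂] at this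
    exact absurd this (not_le.2 hlt)
  have hbij : Set.BijOn (fun p : X.Pos n => fold (p.2, c p.1)) (places A) (limb A) := by
    refine ⟨?_, ?_, ?_⟩
    · rintro ⟨k, m⟩ hm
      have hj := hplace hm
      obtain ⟨hkm, hmj, hX, -⟩ := (mem_places hA hj).1 hm
      refine ⟨(k, c k), hj, ?_⟩
      dsimp only
      by_cases hp : (m, c k) ∈ X.posRoots n
      · exact Or.inl (by rw [fold_of_mem hp]; exact ⟨hp, rfl, hkm⟩)
      · refine Or.inr ?_
        rw [fold_of_notMem hp]
        refine (mem_arm hj.1).2 ⟨rfl, mem_posRoots.2 ⟨Fin.rev_lt_rev.2 hmj, Or.inl ?_⟩, ?_⟩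
        · rw [Fin.rev_rev]
          exact hnot hm hp
        · rwa [Fin.rev_rev]
    · rintro ⟨k, m⟩ hm ⟨k', m'⟩ hm' heq
      simp only at heq
      by_cases hp : (m, c k) ∈ X.posRoots n <;> by_cases hp' : (m', c k') ∈ X.posRoots n
      · rw [fold_of_mem hp, fold_of_mem hp', Prod.mk.injEq] at heq
        obtain ⟨rfl, h⟩ := heq
        rw [show k = k' from congrArg Prod.fst (hA (hplace hm) (hplace hm') h)]
      · rw [fold_of_mem hp, fold_of_notMem hp', Prod.mk.injEq] at heq
        exact (hinj hm hm' hp' heq.1 heq.2).elim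
      · rw [fold_of_notMem hp, fold_of_mem hp', Prod.mk.injEq] at heq
        exact (hinj hm' hm hp heq.1.symm heq.2.symm).elim
      · rw [fold_of_notMem hp, fold_of_notMem hp', Prod.mk.injEq] at heq
        obtain rfl := Fin.rev_injective heq.2
        rw [show k = k' from
          congrArg Prod.fst (hA (hplace hm) (hplace hm') (Fin.rev_injective heq.1))]
    · rintro ⟨a, b⟩ ⟨⟨i, j⟩, hj, h | h⟩
      · obtain ⟨hp, rfl : b = j, hia : i < a⟩ := h
        have hab := (mem_posRoots.1 hp).1
        by_cases hpl : (i, a) ∈ places A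
        · refine ⟨(i, a), hpl, ?_⟩
          simp only [hc' hj]
          exact fold_of_mem hp
        · rw [mem_places hA hj] at hpl
          push Not at hpl
          have hX : a.rev = b → X = C := fun h => by
            rcases (mem_posRoots.1 hp).2 with h' | h'
            · exact absurd h' (h ▸ lt_irrefl _)
            · exact h'.1
          -- If `(i, a)` is supplementary, the main condition `(i', ā)` responsible supplies the
          -- place `(i', b̄)`, whose mirrored image is `(a, b)`.
          obtain ⟨i', hi', hii, haa, hlt⟩ := hpl hia hab hX
          have hi'a : i' ≤ a := Fin.rev_le_rev.1 (le_rev_of_mem_posRoots hi'.1)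
          refine ⟨(i', b.rev), (mem_places hA hi').2 ⟨hi'a.trans_lt hlt, Fin.rev_lt_rev.2 hab,
            fun h => ?_, fun _ _ _ _ => ?_⟩, ?_⟩
          · rw [Fin.rev_rev] at h
            rw [h, Fin.rev_rev] at hlt
            exact absurd hlt (lt_irrefl _)
          · rw [Fin.rev_rev]
            exact hlt.le
          · simp only [hc' hi']
            rw [fold_of_notMem, Fin.rev_rev, Fin.rev_rev]
            rw [mem_posRoots]
            push Not
            intro _
            rw [Fin.rev_rev]
            have := Fin.lt_rev_iff.1 hlt
            exact ⟨this.le, fun _ => this.ne'⟩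
      · obtain ⟨rfl, hp, hib⟩ := (mem_arm hj.1).1 h
        have hjb := (mem_posRoots.1 hp).1
        have hbj : b ≤ j := by
          have := le_rev_of_mem_posRoots hp
          rwa [Fin.rev_rev] at this
        refine ⟨(i, b.rev), (mem_places hA hj).2 ⟨hib, Fin.rev_lt_iff.2 hjb, fun h => ?_,
          fun _ _ _ _ => Fin.rev_le_rev.2 hbj⟩, ?_⟩
        · rw [Fin.rev_rev] at h
          rcases (mem_posRoots.1 hp).2 with h' | h'
          · rw [h, Fin.rev_rev] at h'
            exact absurd h' (lt_irrefl _)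
          · exact h'.1
        · simp only [hc' hj]
          rcases hbj.lt_or_eq with h' | rfl
          · rw [fold_of_notMem, Fin.rev_rev]
            rw [mem_posRoots]
            push Not
            intro _
            rw [Fin.rev_rev]
            exact ⟨h'.le, fun _ => h'.ne'⟩
          · exact fold_of_mem hp
  rw [← hbij.image_eq, hbij.injOn.ncard_image]

end Places

/-! ### `U_{J(A)}` as the stabilizer of the verge. -/

section Stabilizer

variable {F : Type*} [Field F]

theorem verge_apply_of_mem {A : X.V n F} {i j : X.Idx n} (h : (i, j) ∈ mainConds A) :
    (verge A).val i j = A.val i j := by simp [verge, h]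

theorem verge_apply_of_notMem {A : X.V n F} {i j : X.Idx n} (h : (i, j) ∉ mainConds A) :
    (verge A).val i j = 0 := by simp [verge, h]

/-- Each row of the verge has at most one nonzero entry, so left of a main condition `(i, j)` the
new entry in column `a` is `A i j * g a j`. -/
theorem smul_verge_eq_iff {A : X.V n F} {g : X.sylowU n F} :
    g • verge A = verge A ↔
      ∀ i j a, (i, j) ∈ mainConds A → i < a → a < j → g.val.val a j = 0 := by
  constructor
  · intro h i j a hj hia haj
    have hp := posRoots_of_le hj.1 hia haj.le
    have h₁ : (g • verge A).val i a = (verge A).val i a := by rw [h]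
    rw [smul_apply _ _ hp, Matrix.mul_apply, Finset.sum_eq_single j ?_ (by simp),
      verge_apply_of_mem hj, verge_apply_of_notMem fun h => haj.ne (mainCond_unique h hj),
      transpose_apply] at h₁
    · exact (mul_eq_zero.1 h₁).resolve_left hj.2.1
    · intro d _ hd
      rw [verge_apply_of_notMem fun h => hd (mainCond_unique h hj), zero_mul]
  · intro h
    refine V_ext fun i a hp => ?_
    rw [smul_apply _ _ hp, Matrix.mul_apply, Finset.sum_eq_single a ?_ (by simp), transpose_apply,
      g.2.2.2 a, mul_one]
    intro d _ hd
    rw [transpose_apply]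
    rcases lt_or_gt_of_ne hd with hlt | hlt
    · rw [g.2.2.1 a d hlt, mul_zero]
    · by_cases hm : (i, d) ∈ mainConds A
      · rw [h i d a hm (mem_posRoots.1 hp).1 hlt, mul_zero]
      · rw [verge_apply_of_notMem hm, zero_mul]

/-- If an element of `U` is trivial below the height `k`, then its entries of height `k` at
mirror positions agree up to sign. -/
theorem entry_mirror {g : GL (X.Idx n) F} (hg : g ∈ X.sylowU n F) {k : ℕ} (hk : 1 ≤ k)
    (hz : ∀ a b : X.Idx n, a < b → (b : ℕ) < a + k → g.val a b = 0) {a b : X.Idx n}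
    (hab : (b : ℕ) = a + k) :
    gramSign F a.rev * g.val a b + gramSign F b.rev * g.val b.rev a.rev = 0 := by
  have h : (g.valᵀ * X.gram n F * g.val) a.rev b = X.gram n F a.rev b := by rw [hg.1]
  have hne : a ≠ b := fun h => by rw [h] at hab; omega
  rw [Matrix.mul_assoc, Matrix.mul_apply, gram_apply, Fin.rev_rev, if_neg hne.symm,
    Finset.sum_eq_add a.rev b.rev (fun h => hne (Fin.rev_injective h)) ?_ (by simp) (by simp)] at h
  · simp only [transpose_apply, gram_mul_apply, Fin.rev_rev, hg.2.2, one_mul, mul_one] at h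
    linear_combination h
  · rintro d - ⟨hd₁, hd₂⟩
    rw [transpose_apply, gram_mul_apply]
    by_contra hne
    have h₁ := left_ne_zero_of_mul hne
    have h₂ := right_ne_zero_of_mul (right_ne_zero_of_mul hne)
    have hd₂' : d.rev ≠ b := fun h => hd₂ (by rw [← h, Fin.rev_rev])
    have l₁ : d < a.rev := by
      refine lt_of_le_of_ne ?_ hd₁
      by_contra hlt
      exact h₁ (hg.2.1 _ _ (not_le.1 hlt))
    have l₂ : d.rev < b := by
      refine lt_of_le_of_ne ?_ hd₂'
      by_contra hlt
      exact h₂ (hg.2.1 _ _ (not_le.1 hlt))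
    -- Both factors would need height at least `k`, but their heights add up to `k`.
    have m₁ : (d : ℕ) + k ≤ a.rev := by
      by_contra hlt
      exact h₁ (hz _ _ l₁ (not_le.1 hlt))
    have m₂ : (d.rev : ℕ) + k ≤ b := by
      by_contra hlt
      exact h₂ (hz _ _ l₂ (not_le.1 hlt))
    rw [Fin.val_rev] at m₁ m₂
    have := d.isLt
    omega

/-- A cross term through `a < d < b` involves an entry of `g` of height below `k`, so at lowest
height multiplication is addition. -/
theorem mul_apply_of_height {g u : GL (X.Idx n) F} (hg : g ∈ X.sylowU n F)
    (hu : u ∈ X.sylowU n F) {k : ℕ}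
    (hz : ∀ a b : X.Idx n, a < b → (b : ℕ) < a + k → g.val a b = 0) {a b : X.Idx n}
    (hab : a < b) (hk : (b : ℕ) ≤ a + k) :
    (g * u).val a b = g.val a b + u.val a b := by
  rw [Units.val_mul, Matrix.mul_apply, Finset.sum_eq_add a b hab.ne ?_ (by simp) (by simp),
    hg.2.2, hu.2.2, one_mul, mul_one, add_comm]
  rintro d - ⟨hd₁, hd₂⟩
  rcases lt_or_gt_of_ne hd₁ with h | h
  · rw [hg.2.1 _ _ h, zero_mul]
  · rcases lt_or_gt_of_ne hd₂ with h' | h'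
    · rw [hz a d h (lt_of_lt_of_le h' hk), zero_mul]
    · rw [hu.2.1 _ _ h', mul_zero]

theorem smul_verge_of_rootElem (hF : (2 : F) ≠ 0) {A : X.V n F} {p : X.Pos n}
    (hp : p ∈ complLimb A) {α : F} {g : X.sylowU n F} (hg : g.val.val = X.rootElem n p α) :
    g • verge A = verge A := by
  obtain ⟨a, b⟩ := p
  rw [smul_verge_eq_iff]
  intro i j c hj hic hcj
  by_contra hne
  rw [hg] at hne
  have hab := (mem_posRoots.1 hp.1).1
  rcases (rootElem_apply hF hp.1 α).2.2 c j hcj.ne hne with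
    ⟨rfl, rfl⟩ | ⟨rfl, rfl⟩ | ⟨hb, rfl, rfl⟩
  · exact hp.2 ⟨_, hj, Or.inl ⟨hp.1, rfl, hic⟩⟩
  · exact hp.2 ⟨_, hj, Or.inr ((mem_arm hj.1).2 ⟨by rw [Fin.rev_rev], hp.1, hic⟩)⟩
  · exact hp.2 ⟨_, hj, Or.inr ((mem_arm hj.1).2
      ⟨by rw [Fin.rev_rev], hp.1, hb ▸ hic.trans hab⟩)⟩

/-- Stabilizing the verge kills leg entries directly, and arm entries through the mirror relation
valid at lowest height. -/
theorem mem_complLimb_of_entry_ne_zero {A : X.V n F} {g : X.sylowU n F}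
    (hg : g • verge A = verge A) {k : ℕ} (hk : 1 ≤ k)
    (hz : ∀ a b : X.Idx n, a < b → (b : ℕ) < a + k → g.val.val a b = 0) {a b : X.Idx n}
    (hp : (a, b) ∈ X.posRoots n) (hab : (b : ℕ) = a + k) (hne : g.val.val a b ≠ 0) :
    (a, b) ∈ complLimb A := by
  rw [smul_verge_eq_iff] at hg
  have hlt := (mem_posRoots.1 hp).1
  refine ⟨hp, ?_⟩
  rintro ⟨⟨i, j⟩, hj, h | h⟩
  · obtain ⟨-, rfl : b = j, hia⟩ := h
    exact hne (hg i b a hj hia hlt)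
  · obtain ⟨rfl, -, hib⟩ := (mem_arm hj.1).1 h
    have h₁ := entry_mirror g.2 hk hz hab
    rw [Fin.rev_rev, hg i j b.rev hj hib (Fin.rev_lt_iff.2 hlt), mul_zero, add_zero] at h₁
    exact hne ((mul_eq_zero.1 h₁).resolve_left (gramSign_ne_zero _))

/-- If an element of `U` has only zero entries at the positive roots up to some height, then it
is trivial up to that height. -/
theorem entry_eq_zero_of_posRoots (hF : (2 : F) ≠ 0) {g : GL (X.Idx n) F}
    (hg : g ∈ X.sylowU n F) {k : ℕ} (hk : 1 ≤ k)
    (hz : ∀ a b : X.Idx n, a < b → (b : ℕ) < a + k → g.val a b = 0)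
    (hroot : ∀ a b : X.Idx n, (a, b) ∈ X.posRoots n → (b : ℕ) = a + k → g.val a b = 0)
    {a b : X.Idx n} (hab : (b : ℕ) = a + k) : g.val a b = 0 := by
  have hlt : a < b := by rw [Fin.lt_def]; omega
  by_cases hp : (a, b) ∈ X.posRoots n
  · exact hroot a b hp hab
  have h₁ := entry_mirror hg hk hz hab
  rw [mem_posRoots] at hp
  push Not at hp
  obtain ⟨h₂, h₃⟩ := hp hlt
  rcases h₂.lt_or_eq with h | h
  · rw [hroot b.rev a.rev, mul_zero, add_zero] at h₁
    · exact (mul_eq_zero.1 h₁).resolve_left (gramSign_ne_zero _)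
    · refine mem_posRoots.2 ⟨Fin.rev_lt_rev.2 hlt, Or.inl ?_⟩
      rwa [Fin.rev_rev]
    · rw [Fin.val_rev, Fin.val_rev]
      have := b.isLt
      omega
  -- Outside type C an antidiagonal entry is its own mirror, so twice it vanishes.
  · have hX : X ≠ C := fun hX => h₃ hX h.symm
    rw [← h, Fin.rev_rev, gramSign_of_ne_C hX, gramSign_of_ne_C hX] at h₁
    rw [← h]
    refine (mul_eq_zero.1 (?_ : 2 * g.val a a.rev = 0)).resolve_left hF
    linear_combination h₁

/-- Elimination by height: a nonzero root entry of lowest height `k` lies in `J(A)` and is cancelled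
by a root element, which also fixes the verge. The outer induction is on the remaining heights `e`,
the inner one on the number of nonzero root entries of height `k`. -/
theorem mem_patternSubgroup_of_smul_verge (hF : (2 : F) ≠ 0) {A : X.V n F} (e k : ℕ)
    (hk : 1 ≤ k) (hek : k + e = X.size n + 1) (g : X.sylowU n F) (hg : g • verge A = verge A)
    (hz : ∀ a b : X.Idx n, a < b → (b : ℕ) < a + k → g.val.val a b = 0) :
    g.val ∈ X.patternSubgroup n F (complLimb A) := by
  classical
  induction e generalizing k g with
  | zero =>
    have : g.val = 1 := by
      refine Units.ext (Matrix.ext fun i j => ?_)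
      rcases lt_trichotomy i j with h | rfl | h
      · rw [hz i j h (by have := j.isLt; omega), Units.val_one, one_apply_ne h.ne]
      · rw [g.2.2.2, Units.val_one, one_apply_eq]
      · rw [g.2.2.1 i j h, Units.val_one, one_apply_ne h.ne']
    rw [this]
    exact one_mem _
  | succ e ihe =>
    induction hc : (Finset.univ.filter fun p : X.Pos n => p ∈ X.posRoots n ∧
      (p.2 : ℕ) = p.1 + k ∧ g.val.val p.1 p.2 ≠ 0).card using Nat.strong_induction_on
      generalizing g with
    | _ c ihc =>
    by_cases hroot : ∀ a b : X.Idx n, (a, b) ∈ X.posRoots n → (b : ℕ) = a + k →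
        g.val.val a b = 0
    · refine ihe (k + 1) (by omega) (by omega) g hg fun a b hab hlt => ?_
      rcases Nat.lt_or_ge (b : ℕ) (a + k) with h | h
      · exact hz a b hab h
      · exact entry_eq_zero_of_posRoots hF g.2 hk hz hroot (by omega)
    · push Not at hroot
      obtain ⟨a, b, hp, hab, hne⟩ := hroot
      have hJ := mem_complLimb_of_entry_ne_zero hg hk hz hp hab hne
      obtain ⟨u, hu⟩ := exists_eq_rootElem hF hp (-g.val.val a b)
      have huU := mem_sylowU_of_eq_rootElem hF hp hu
      have huJ : u ∈ X.patternSubgroup n F (complLimb A) :=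
        Subgroup.subset_closure ⟨_, hJ, _, hu⟩
      -- The mirror entry of `u` is not at another root, and the quadratic entry of type B has
      -- height `2k`.
      have hentry : ∀ c d : X.Idx n, c < d → (d : ℕ) < c + k ∨
          ((d : ℕ) = c + k ∧ (c, d) ∈ X.posRoots n ∧ (c, d) ≠ (a, b)) → u.val c d = 0 := by
        intro c d hcd h
        by_contra hne'
        rw [hu] at hne'
        have hba := le_rev_of_mem_posRoots hp
        have ha := a.isLt
        have hb := b.isLt
        rcases (rootElem_apply hF hp _).2.2 c d hcd.ne hne' with
          ⟨rfl, rfl⟩ | ⟨rfl, rfl⟩ | ⟨hbb, rfl, rfl⟩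
        · rcases h with h | h
          · omega
          · exact h.2.2 rfl
        · rcases h with h | h
          · rw [Fin.val_rev, Fin.val_rev] at h
            omega
          · have := le_rev_of_mem_posRoots h.2.1
            rw [Fin.rev_rev] at this
            obtain rfl := le_antisymm this hba
            exact h.2.2 (by rw [Fin.rev_rev])
        · have hbb' := congrArg Fin.val hbb
          rw [Fin.val_rev] at hbb'
          rw [Fin.val_rev] at h
          rcases h with h | ⟨h, -⟩ <;> omega
      have hprod : ∀ c d : X.Idx n, c < d → (d : ℕ) ≤ c + k →
          (g * ⟨u, huU⟩ : X.sylowU n F).val.val c d = g.val.val c d + u.val c d :=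
        fun c d hcd hle => mul_apply_of_height g.2 huU hz hcd hle
      have hmem : (g * ⟨u, huU⟩ : X.sylowU n F).val ∈ X.patternSubgroup n F (complLimb A) := by
        refine ihc _ ?_ (g * ⟨u, huU⟩) ?_ (fun c d hcd hlt => ?_) rfl
        · rw [← hc]
          refine Finset.card_lt_card ⟨fun p hp' => ?_, fun hsub => ?_⟩
          · obtain ⟨-, hp₁, hp₂, hp₃⟩ := Finset.mem_filter.1 hp'
            have hlt := (mem_posRoots.1 hp₁).1
            rw [hprod _ _ hlt hp₂.le] at hp₃
            refine Finset.mem_filter.2 ⟨Finset.mem_univ _, hp₁, hp₂, ?_⟩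
            by_cases heq : p = (a, b)
            · rw [heq]
              exact hne
            · rwa [hentry _ _ hlt (Or.inr ⟨hp₂, hp₁, heq⟩), add_zero] at hp₃
          · have h := hsub (Finset.mem_filter.2 ⟨Finset.mem_univ (a, b), hp, hab, hne⟩)
            refine (Finset.mem_filter.1 h).2.2.2 ?_
            rw [hprod _ _ (mem_posRoots.1 hp).1 hab.le, hu, (rootElem_apply hF hp _).1,
              add_neg_cancel]
        · rw [mul_smul, smul_verge_of_rootElem hF hJ hu, hg]
        · rw [hprod c d hcd hlt.le, hz c d hcd hlt, hentry c d hcd (Or.inl hlt), add_zero]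
      exact (Subgroup.mul_mem_cancel_right _ huJ).1 hmem

theorem subgroupOf_patternSubgroup_complLimb (hF : (2 : F) ≠ 0) (A : X.V n F) :
    (X.patternSubgroup n F (complLimb A)).subgroupOf (X.sylowU n F) =
      MulAction.stabilizer (X.sylowU n F) (verge A) := by
  refine le_antisymm ?_ fun g hg => ?_
  · have hle : X.patternSubgroup n F (complLimb A) ≤
        (MulAction.stabilizer (X.sylowU n F) (verge A)).map (X.sylowU n F).subtype := by
      rw [patternSubgroup, Subgroup.closure_le]
      rintro g ⟨p, hp, α, hg⟩
      exact ⟨⟨g, mem_sylowU_of_eq_rootElem hF hp.1 hg⟩, smul_verge_of_rootElem hF hp hg, rfl⟩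
    intro g hg
    obtain ⟨u, hu, hug⟩ := hle hg
    rwa [← Subtype.ext hug]
  -- At `k = 1` the vanishing hypothesis is vacuous.
  · refine mem_patternSubgroup_of_smul_verge hF (X.size n) 1 le_rfl (by omega) g hg ?_
    intro a b hab hlt
    rw [Fin.lt_def] at hab
    omega

end Stabilizer

/-! ### Core characters, orbit sizes and the classification. -/

section Main

variable {F : Type*} [Field F]

theorem mem_orbit_iff {θ : AddChar F ℂ} (hθ : θ ≠ 1) {A B : X.V n F} :
    bracket θ B ∈ orbit θ A ↔ B ∈ MulAction.orbit (X.sylowU n F) A := by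
  rw [orbit_eq_image, (bracket_injective hθ).mem_set_image]

theorem orbit_eq_orbit_iff {θ : AddChar F ℂ} (hθ : θ ≠ 1) {A B : X.V n F} :
    orbit θ A = orbit θ B ↔ bracket θ A ∈ orbit θ B := by
  rw [orbit_eq_image, orbit_eq_image, (bracket_injective hθ).image_injective.eq_iff,
    MulAction.orbit_eq_iff, (bracket_injective hθ).mem_set_image]

/-- A nonzero entry outside the core has a main condition strictly to its right, so it sits at a
place. -/
theorem isCore_iff {A : X.V n F} (hA : IsStaircase A) :
    IsCore A ↔ ∀ k m, (k, m) ∈ places A → A.val k m = 0 := by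
  constructor
  · intro h k m hm
    by_contra hne
    exact hm.2.1 (h.2 k m hne)
  · intro h
    refine ⟨hA, fun k m hne => ?_⟩
    by_contra hcore
    obtain ⟨j, hmj, hj⟩ := exists_mainCond A hne
    refine hne (h k m ⟨?_, hcore, (k, j), hj, rfl, lt_of_le_of_ne hmj ?_⟩)
    · by_contra hp
      exact hne (A.property k m hp)
    · rintro rfl
      exact hcore (Or.inl hj)

/-- Elements of a staircase orbit correspond to arbitrary entries at the places. -/
theorem existsUnique_mem_orbit (hF : (2 : F) ≠ 0) {A : X.V n F} (hA : IsStaircase A)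
    (Λ : places A → F) :
    ∃ B ∈ MulAction.orbit (X.sylowU n F) A, ∀ B', (B' ∈ MulAction.orbit (X.sylowU n F) A ∧
      ∀ p : places A, B'.val p.val.1 p.val.2 = Λ p) ↔ B' = B := by
  classical
  obtain ⟨g, hg⟩ := exists_smul_places hF hA
    fun k m => if h : (k, m) ∈ places A then Λ ⟨(k, m), h⟩ else 0
  have hg' : ∀ p : places A, (g • A).val p.val.1 p.val.2 = Λ p := by
    rintro ⟨⟨k, m⟩, hp⟩
    rw [hg k m hp, dif_pos hp]
  refine ⟨g • A, ⟨g, rfl⟩, fun B' => ⟨?_, ?_⟩⟩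
  · rintro ⟨⟨h, rfl⟩, hh⟩
    refine smul_eq_smul_of_places hF hA fun k m hp => ?_
    exact (hh ⟨(k, m), hp⟩).trans (hg' ⟨(k, m), hp⟩).symm
  · rintro rfl
    exact ⟨⟨g, rfl⟩, hg'⟩

theorem ncard_orbit (hF : (2 : F) ≠ 0) [Fintype F] {A : X.V n F} (hA : IsStaircase A) :
    (MulAction.orbit (X.sylowU n F) A).ncard = Fintype.card F ^ (places A).ncard := by
  classical
  let r : MulAction.orbit (X.sylowU n F) A → (places A → F) :=
    fun B p => B.val.val p.val.1 p.val.2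
  have hr : Function.Bijective r := by
    constructor
    · intro B B' h
      obtain ⟨B₀, -, hB₀⟩ := existsUnique_mem_orbit hF hA (r B')
      exact Subtype.ext (((hB₀ B).1 ⟨B.2, fun p => congrFun h p⟩).trans
        ((hB₀ B').1 ⟨B'.2, fun p => rfl⟩).symm)
    · intro Λ
      obtain ⟨B₀, hmem, hB₀⟩ := existsUnique_mem_orbit hF hA Λ
      exact ⟨⟨B₀, hmem⟩, funext ((hB₀ B₀).2 rfl).2⟩
  rw [← Nat.card_coe_set_eq, Nat.card_congr (Equiv.ofBijective r hr), Nat.card_fun,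
    Nat.card_eq_fintype_card, Nat.card_coe_set_eq]

end Main

end LieType

end

theorem theorem4 (X : LieType) (n : ℕ) (F : Type*) [Field F] [Fintype F] (hF : ringChar F ≠ 2)
    (θ : AddChar F ℂ) (hθ : θ ≠ 1) :
    (∀ A : X.V n F, LieType.IsStaircase A →
      (∃ B : (LieType.places A → F) → X.V n F,
        (∀ Λ : LieType.places A → F, ∀ C : X.V n F,
          (LieType.bracket θ C ∈ LieType.orbit θ A ∧
            ∀ p : LieType.places A, C.val p.val.1 p.val.2 = Λ p) ↔ C = B Λ) ∧
        Set.BijOn (fun Λ => LieType.bracket θ (B Λ)) Set.univ (LieType.orbit θ A) ∧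
        (∀ C : X.V n F,
          (LieType.bracket θ C ∈ LieType.orbit θ A ∧ LieType.IsCore C) ↔ C = B (fun _ => 0))) ∧
      (LieType.orbit θ A).ncard = Fintype.card F ^ (LieType.places A).ncard ∧
      (LieType.orbit θ A).ncard = Fintype.card F ^ (LieType.limb A).ncard ∧
      (LieType.orbit θ A).ncard = Fintype.card F ^ (LieType.limb (LieType.verge A)).ncard ∧
      X.patternSubgroup n F (LieType.complLimb A) ≤ X.sylowU n F ∧
      (LieType.orbit θ A).ncard =
        (X.patternSubgroup n F (LieType.complLimb A)).relIndex (X.sylowU n F)) ∧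
    Set.BijOn (fun A : X.V n F => LieType.orbit θ A) {A | LieType.IsCore A}
      {O | ∃ A : X.V n F, LieType.IsStaircase A ∧ O = LieType.orbit θ A} := by
  have h2 : (2 : F) ≠ 0 := Ring.two_ne_zero hF
  have hcore : ∀ A : X.V n F, LieType.IsStaircase A → ∀ C : X.V n F,
      (LieType.bracket θ C ∈ LieType.orbit θ A ∧ LieType.IsCore C) ↔
        (C ∈ MulAction.orbit (X.sylowU n F) A ∧
          ∀ p : LieType.places A, C.val p.val.1 p.val.2 = 0) := by
    intro A hA C
    rw [LieType.mem_orbit_iff hθ]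
    refine and_congr_right fun hC => ?_
    have hm := LieType.mainConds_of_mem_orbit hC
    rw [LieType.isCore_iff ((LieType.isStaircase_congr hm).2 hA), LieType.places_congr hm]
    exact ⟨fun h p => h _ _ p.2, fun h k m hp => h ⟨(k, m), hp⟩⟩
  refine ⟨fun A hA => ?_, ?_, ?_, ?_⟩
  · choose B hmem hB using LieType.existsUnique_mem_orbit h2 hA
    have hcard : (LieType.orbit θ A).ncard = Fintype.card F ^ (LieType.places A).ncard := by
      rw [LieType.orbit_eq_image, Set.ncard_image_of_injective _ (LieType.bracket_injective hθ),
        LieType.ncard_orbit h2 hA]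
    have hv := LieType.mainConds_verge A
    refine ⟨⟨B, fun Λ C => ?_, ⟨fun Λ _ => ?_, fun Λ _ Λ' _ h => ?_, fun χ hχ => ?_⟩,
      fun C => ?_⟩, hcard, ?_, ?_, ?_, ?_⟩
    · rw [LieType.mem_orbit_iff hθ]
      exact hB Λ C
    · exact (LieType.mem_orbit_iff hθ).2 (hmem Λ)
    · have h' := LieType.bracket_injective hθ h
      funext p
      rw [← ((hB Λ (B Λ)).2 rfl).2 p, ← ((hB Λ' (B Λ')).2 rfl).2 p, h']
    · rw [LieType.orbit_eq_image] at hχ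
      obtain ⟨C, hC, rfl⟩ := hχ
      refine ⟨fun p => C.val p.val.1 p.val.2, Set.mem_univ _, ?_⟩
      change LieType.bracket θ (B _) = _
      rw [← (hB _ C).1 ⟨hC, fun p => rfl⟩]
    · rw [hcore A hA C]
      exact hB (fun _ => 0) C
    · rw [hcard, LieType.ncard_places_eq_ncard_limb hA]
    · rw [hcard, LieType.ncard_places_eq_ncard_limb hA, LieType.limb_congr hv]
    · exact LieType.patternSubgroup_le_sylowU h2 fun p hp => hp.1
    · rw [hcard, Subgroup.relIndex, LieType.subgroupOf_patternSubgroup_complLimb h2,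
        MulAction.index_stabilizer,
        LieType.ncard_orbit h2 ((LieType.isStaircase_congr hv).2 hA), LieType.places_congr hv]
  · exact fun A hA => ⟨A, hA.1, rfl⟩
  -- Both core characters lie in the same orbit and vanish at its places, so they coincide.
  · intro A hA A' hA' h
    obtain ⟨B, -, hB⟩ := LieType.existsUnique_mem_orbit h2 hA'.1 (fun _ => 0)
    have h₁ := (hcore A' hA'.1 A).1 ⟨(LieType.orbit_eq_orbit_iff hθ).1 h, hA⟩
    have h₂ := (hcore A' hA'.1 A').1 ⟨(LieType.orbit_eq_orbit_iff hθ).1 rfl, hA'⟩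
    exact ((hB A).1 h₁).trans ((hB A').1 h₂).symm
  · rintro O ⟨A, hA, rfl⟩
    obtain ⟨B, -, hB⟩ := LieType.existsUnique_mem_orbit h2 hA (fun _ => 0)
    have h := (hcore A hA B).2 ((hB B).2 rfl)
    exact ⟨B, h.2, (LieType.orbit_eq_orbit_iff hθ).2 h.1⟩
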